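/- Let $A\in\mathbb{R}^{m\times n}$ and $b\in\mathbb{R}^m$ be such that $\{x: Ax=b\}\neq\emptyset$ and $A\neq 0$, and consider $\min_{x\in\mathbb{R}^n} f(x):=h(x)+g(x)$ subject to $Ax=b$, where * $h:\mathbb{R}^n\to\mathbb{R}$ is differentiable and $\nabla h$ is Lipschitz continuous with constant $L_h>0$; * $g:\mathbb{R}^n\to\mathbb{R}\cup\{+\infty\}$ is proper, lower semicontinuous and $\rho_g$-weakly convex, i.e. $g+\frac{\rho_g}{2}\|\cdot\|^2$ is convex, with $\rho_g>0$; * $g$ has the implicit Lipschitz subgradient property with constants $L_g=L_g(\gamma)>0$: for every $\gamma\in(0,\rho_g^{-1})$ and all $w,w'\in\mathbb{R}^n$, $\|\nabla\mathcal{M}_{\gamma,g}(w)-\nabla\mathcal{M}_{\gamma,g}(w')\|\le L_g(\gamma)\,\|\mathrm{Prox}_{\gamma,g}(w)-\mathrm{Prox}_{\gamma,g}(w')\|$. Here $\mathcal{M}_{\gamma,g}(z)=\min_x\{g(x)+\frac{1}{2\gamma}\|x-z\|^2\}$ is the Moreau envelope and $\mathrm{Prox}_{\gamma,g}(z)=\operatorname{argmin}_x\{g(x)+\frac{1}{2\gamma}\|x-z\|^2\}$.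 Fix $\beta>0$, $\eta\in(0,2)$ and $\gamma\in\left(0,\frac{1}{\rho_g+L_h}\right)$, let $\tilde\sigma_{\min}(A^TA)$ be the smallest positive eigenvalue of $A^TA$, write $L_g=L_g(\gamma)$ for this $\gamma$, and put $$\alpha:=\frac{2\beta+\gamma\eta(1-\eta/2)}{2\gamma^2\tilde\sigma_{\min}(A^TA)\beta^2}.$$ Assume $$0<\alpha<\min\left\{\frac{1}{8\gamma}\Big(\frac{2}{\eta}-1\Big),\ \frac{1-\gamma(\rho_g+L_h)}{8\gamma\big((1+\gamma L_g)^2+\gamma^2L_h^2\big)}\right\}.$$ Let $\{(x^k,z^k,\lambda^k)\}_{k\ge 0}$ be a bounded sequence generated by LiMEAL from an arbitrary $(x^0,z^0,\lambda^0)$, i.e. for all $k\ge 0$ $$x^{k+1}=\operatorname{argmin}_x\Big\{h(x^k)+\langle\nabla h(x^k),x-x^k\rangle+g(x)+\langle\lambda^k,Ax-b\rangle+\tfrac{\beta}{2}\|Ax-b\|^2+\tfrac{1}{2\gamma}\|x-z^k\|^2\Big\},$$ $$z^{k+1}=z^k-\eta(z^k-x^{k+1}),\qquad \lambda^{k+1}=\lambda^k+\beta(Ax^{k+1}-b).$$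 For $y=(x,z,\lambda,\hat x,\hat z)$ define $$\mathcal{P}_{\mathrm{limeal}}(y):=f(x)+\langle\lambda,Ax-b\rangle+\tfrac{\beta}{2}\|Ax-b\|^2+\tfrac{1}{2\gamma}\|x-z\|^2+4\alpha\big(\|z-\hat z\|^2+\gamma^2L_h^2\|x-\hat x\|^2\big).$$ Let $(x^*,\lambda^*)$ be a limit point of $\{(x^k,\lambda^k)\}$ and suppose that $\mathcal{P}_{\mathrm{limeal}}$ has the Kurdyka–Łojasiewicz property at $y^*:=(x^*,x^*,\lambda^*,x^*,x^*)$ with exponent $\theta\in[0,1)$. That is, with $\partial$ the limiting subdifferential, $\partial\mathcal{P}_{\mathrm{limeal}}(y^*)\ne\emptyset$, and there are a neighborhood $U$ of $y^*$ and constants $\nu,c'>0$ such that, with $\varphi(s)=c's^{1-\theta}$, $\varphi'\big(\mathcal{P}_{\mathrm{limeal}}(y)-\mathcal{P}_{\mathrm{limeal}}(y^*)\big)\cdot\mathrm{dist}\big(0,\partial\mathcal{P}_{\mathrm{limeal}}(y)\big)\ge 1$ for all $y\in U$ with $\partial\mathcal{P}_{\mathrm{limeal}}(y)\neq\emptyset$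 and $\mathcal{P}_{\mathrm{limeal}}(y^*)<\mathcal{P}_{\mathrm{limeal}}(y)<\mathcal{P}_{\mathrm{limeal}}(y^*)+\nu$. Then: (a) the whole sequence $\hat y^k:=(x^k,z^k,\lambda^k)$ converges to $\hat y^*:=(x^*,x^*,\lambda^*)$; (b) (1) if $\theta=0$, then $\hat y^k=\hat y^*$ for all sufficiently large $k$; (2) if $\theta\in(0,\frac12]$, then there are $k_0>0$, $c>0$ and $\tau\in(0,1)$ with $\|\hat y^k-\hat y^*\|\le c\,\tau^k$ for all $k\ge k_0$; (3) if $\theta\in(\frac12,1)$, then there are $k_0>0$ and $c>0$ with $\|\hat y^k-\hat y^*\|\le c\,k^{-\frac{1-\theta}{2\theta-1}}$ for all $k\ge k_0$. -/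

import Mathlib

open Filter Topology

noncomputable section

namespace LiMEAL

/-! ### Extended-real-valued functions on a Euclidean space -/

section Functions

/-- `φ : E → ℝ ∪ {+∞}` is proper: it never takes the value `-∞` and is finite somewhere. -/
def Proper {E : Type*} (φ : E → EReal) : Prop :=
  (∀ x, φ x ≠ ⊥) ∧ ∃ x, φ x ≠ ⊤

/-- An extended-real-valued function is convex if its epigraph is a convex set. -/
def ConvexFun {E : Type*} [NormedAddCommGroup E] [InnerProductSpace ℝ E] (φ : E → EReal) : Prop :=
  Convex ℝ {p : E × ℝ | φ p.1 ≤ (p.2 : EReal)}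

/-- `φ` is weakly convex with modulus `ρ`: the function `φ + (ρ / 2) ‖·‖ ^ 2` is convex. -/
def WeaklyConvex {E : Type*} [NormedAddCommGroup E] [InnerProductSpace ℝ E]
    (ρ : ℝ) (φ : E → EReal) : Prop :=
  ConvexFun fun x => φ x + ((ρ / 2 * ‖x‖ ^ 2 : ℝ) : EReal)

/-- The set `argmin_x { φ x + ‖x - z‖ ^ 2 / (2 γ) }`. (It is a singleton when `φ` is proper, lower
semicontinuous and `ρ`-weakly convex with `0 < γ < 1 / ρ`.) -/
def Prox {E : Type*} [NormedAddCommGroup E] (γ : ℝ) (φ : E → EReal) (z : E) : Set E :=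
  {x | ∀ y, φ x + ((‖x - z‖ ^ 2 / (2 * γ) : ℝ) : EReal)
      ≤ φ y + ((‖y - z‖ ^ 2 / (2 * γ) : ℝ) : EReal)}

/-- The Moreau envelope `z ↦ min_x { φ x + ‖x - z‖ ^ 2 / (2 γ) }`. -/
def moreauEnvelope {E : Type*} [NormedAddCommGroup E] (γ : ℝ) (φ : E → EReal) (z : E) : EReal :=
  ⨅ x, φ x + ((‖x - z‖ ^ 2 / (2 * γ) : ℝ) : EReal)

/-- The gradient of the Moreau envelope. (For a proper, lower semicontinuous, `ρ`-weakly convex `φ`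
and `0 < γ < 1 / ρ`, the envelope is finite and differentiable everywhere.) -/
def gradMoreau {E : Type*} [NormedAddCommGroup E] [InnerProductSpace ℝ E] [CompleteSpace E]
    (γ : ℝ) (φ : E → EReal) (w : E) : E :=
  gradient (fun z => (moreauEnvelope γ φ z).toReal) w

/-- The implicit Lipschitz subgradient property of a `ρ`-weakly convex function, with constants
`L γ > 0` that may depend on `γ ∈ (0, 1 / ρ)`: for all `u, v` in the range of `Prox_{γ,φ}`, and all
`w ∈ Prox_{γ,φ}⁻¹(u)`, `w' ∈ Prox_{γ,φ}⁻¹(v)`, the gradients of the Moreau envelope at `w` and `w'`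
differ by at most `L γ * ‖u - v‖`. -/
def ImplicitLipschitzSubgradient {E : Type*} [NormedAddCommGroup E] [InnerProductSpace ℝ E]
    [CompleteSpace E] (ρ : ℝ) (φ : E → EReal) (L : ℝ → ℝ) : Prop :=
  ∀ γ : ℝ, 0 < γ → γ < ρ⁻¹ → 0 < L γ ∧
    ∀ u v w w' : E, u ∈ Prox γ φ w → v ∈ Prox γ φ w' →
      ‖gradMoreau γ φ w - gradMoreau γ φ w'‖ ≤ L γ * ‖u - v‖

/-- The Fréchet subdifferential of `φ` at `x`: it is empty when `φ x = +∞`, and otherwise consists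
of the `v` with `φ u ≥ φ x + ⟪v, u - x⟫ - o(‖u - x‖)` as `u → x`, that is, with
`liminf_{u → x, u ≠ x} (φ u - φ x - ⟪v, u - x⟫) / ‖u - x‖ ≥ 0`. -/
def frechetSubdiff {E : Type*} [NormedAddCommGroup E] [InnerProductSpace ℝ E]
    (φ : E → EReal) (x : E) : Set E :=
  {v | φ x ≠ ⊤ ∧ ∀ ε : ℝ, 0 < ε →
    ∀ᶠ u in 𝓝 x, φ x + ((inner ℝ v (u - x) - ε * ‖u - x‖ : ℝ) : EReal) ≤ φ u}

/-- The limiting subdifferential of `φ` at `x`. -/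
def limitingSubdiff {E : Type*} [NormedAddCommGroup E] [InnerProductSpace ℝ E]
    (φ : E → EReal) (x : E) : Set E :=
  {v | φ x ≠ ⊤ ∧ ∃ (xs vs : ℕ → E), Tendsto xs atTop (𝓝 x) ∧
    Tendsto (fun t => φ (xs t)) atTop (𝓝 (φ x)) ∧
    (∀ t, vs t ∈ frechetSubdiff φ (xs t)) ∧ Tendsto vs atTop (𝓝 v)}

/-- The domain of the limiting subdifferential. -/
def domSubdiff {E : Type*} [NormedAddCommGroup E] [InnerProductSpace ℝ E]
    (φ : E → EReal) : Set E :=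
  {x | (limitingSubdiff φ x).Nonempty}

/-- `φ` has the Kurdyka–Łojasiewicz property at `xs` with exponent `θ`: the point `xs` lies in the
domain of the subdifferential and, with the desingularizing function `s ↦ c * s ^ (1 - θ)`, the
Kurdyka–Łojasiewicz inequality holds at all points near `xs` in the domain of the subdifferential
with value in `(φ xs, φ xs + ν)`. -/
def HasKLProperty {E : Type*} [NormedAddCommGroup E] [InnerProductSpace ℝ E]
    (φ : E → EReal) (xs : E) (θ : ℝ) : Prop :=
  xs ∈ domSubdiff φ ∧
  ∃ U ∈ 𝓝 xs, ∃ ν : ℝ, 0 < ν ∧ ∃ c : ℝ, 0 < c ∧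
    ∀ x ∈ U ∩ domSubdiff φ, φ xs < φ x → φ x < φ xs + (ν : EReal) →
      1 ≤ deriv (fun s : ℝ => c * s ^ (1 - θ)) ((φ x).toReal - (φ xs).toReal)
        * Metric.infDist 0 (limitingSubdiff φ x)

end Functions

/-! ### The linearized Moreau envelope augmented Lagrangian method -/

section Algorithm

/-- `ℝ^d` with the Euclidean norm. -/
abbrev Vec (d : ℕ) : Type := EuclideanSpace ℝ (Fin d)

/-- The space of the points `(x, z, lam)`, with the Euclidean norm. -/
abbrev Triple (n m : ℕ) : Type := WithLp 2 (Vec n × WithLp 2 (Vec n × Vec m))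

/-- The point `(x, z, lam)`. -/
def triple {n m : ℕ} (x z : Vec n) (lam : Vec m) : Triple n m :=
  WithLp.toLp 2 (x, WithLp.toLp 2 (z, lam))

/-- The space of the points `y = (x, z, lam, x', z')`, with the Euclidean norm. -/
abbrev State (n m : ℕ) : Type :=
  WithLp 2 (Vec n × WithLp 2 (Vec n × WithLp 2 (Vec m × WithLp 2 (Vec n × Vec n))))

/-- The point `(x, z, lam, x', z')`. -/
def state {n m : ℕ} (x z : Vec n) (lam : Vec m) (x' z' : Vec n) : State n m :=
  WithLp.toLp 2 (x, WithLp.toLp 2 (z, WithLp.toLp 2 (lam, WithLp.toLp 2 (x', z'))))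

/-- The augmented Lagrangian `f x + ⟪lam, A x - b⟫ + (β / 2) ‖A x - b‖ ^ 2`. -/
def augLagrangian {n m : ℕ} (A : Matrix (Fin m) (Fin n) ℝ) (b : Vec m) (β : ℝ)
    (f : Vec n → EReal) (x : Vec n) (lam : Vec m) : EReal :=
  f x + ((inner ℝ lam (A.toEuclideanLin x - b)
    + β / 2 * ‖A.toEuclideanLin x - b‖ ^ 2 : ℝ) : EReal)

/-- The composite objective `f = h + g`. -/
def objective {n : ℕ} (h : Vec n → ℝ) (g : Vec n → EReal) (x : Vec n) : EReal :=
  (h x : EReal) + g x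

/-- The linearized objective `f^k(x) = h(x^k) + ⟪∇h(x^k), x - x^k⟫ + g(x)`; here `xk` is `x^k`. -/
def linObjective {n : ℕ} (h : Vec n → ℝ) (g : Vec n → EReal) (xk x : Vec n) : EReal :=
  ((h xk + inner ℝ (gradient h xk) (x - xk) : ℝ) : EReal) + g x

/-- The sequence `(x^k, z^k, lam^k)` is generated by LiMEAL with the fixed penalty parameter `β`,
from some initial point `(x^0, z^0, lam^0)`. -/
def IsLiMEALSequence {n m : ℕ} (A : Matrix (Fin m) (Fin n) ℝ) (b : Vec m)
    (h : Vec n → ℝ) (g : Vec n → EReal) (β γ η : ℝ)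
    (x z : ℕ → Vec n) (lam : ℕ → Vec m) : Prop :=
  ∀ k : ℕ,
    x (k + 1) ∈ Prox γ (fun u => augLagrangian A b β (linObjective h g (x k)) u (lam k)) (z k) ∧
    z (k + 1) = z k - η • (z k - x (k + 1)) ∧
    lam (k + 1) = lam k + β • (A.toEuclideanLin (x (k + 1)) - b)

/-- The smallest positive eigenvalue of `Aᵀ A`. It exists if and only if `A ≠ 0`; for `A = 0` this
is the default value `0`. -/
def sigmaMin {n m : ℕ} (A : Matrix (Fin m) (Fin n) ℝ) : ℝ :=
  sInf {μ : ℝ | 0 < μ ∧ Module.End.HasEigenvalue (Matrix.toLin' (A.transpose * A)) μ}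

/-- The parameter `α = (2 β + γ η (1 - η / 2)) / (2 c β ^ 2)` with `c = γ ^ 2 σ`, where `σ` is the
smallest positive eigenvalue of `Aᵀ A`. (For `A = 0`, where it is undefined, this reads `0`, so that
the condition `0 < α` fails.) -/
def alpha {n m : ℕ} (A : Matrix (Fin m) (Fin n) ℝ) (β γ η : ℝ) : ℝ :=
  (2 * β + γ * η * (1 - η / 2)) / (2 * (γ ^ 2 * sigmaMin A) * β ^ 2)

/-- The function `P_β(x, z, lam) = L_β(x, lam) + ‖x - z‖ ^ 2 / (2 γ)`. -/
def proxAugLagrangian {n m : ℕ} (A : Matrix (Fin m) (Fin n) ℝ) (b : Vec m) (β γ : ℝ)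
    (f : Vec n → EReal) (x z : Vec n) (lam : Vec m) : EReal :=
  augLagrangian A b β f x lam + ((‖x - z‖ ^ 2 / (2 * γ) : ℝ) : EReal)

/-- The Lyapunov function
`P_limeal(x, z, lam, x', z') = P_β(x, z, lam) + 4 α (‖z - z'‖ ^ 2 + γ ^ 2 L_h ^ 2 ‖x - x'‖ ^ 2)`. -/
def lyapunov {n m : ℕ} (A : Matrix (Fin m) (Fin n) ℝ) (b : Vec m)
    (h : Vec n → ℝ) (g : Vec n → EReal) (β γ η Lh : ℝ) (y : State n m) : EReal :=
  let x : Vec n := y.fst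
  let z : Vec n := y.snd.fst
  let lam : Vec m := y.snd.snd.fst
  let x' : Vec n := y.snd.snd.snd.fst
  let z' : Vec n := y.snd.snd.snd.snd
  proxAugLagrangian A b β γ (objective h g) x z lam
    + ((4 * alpha A β γ η * (‖z - z'‖ ^ 2 + γ ^ 2 * Lh ^ 2 * ‖x - x'‖ ^ 2) : ℝ) : EReal)

end Algorithm

end LiMEAL

end

/-!
The proof is a Lyapunov argument. Write `y k` for `(x k, z k, lam k)`.

*Subgradients.* The optimality condition of the `x`-update produces a vector `s` with
`g u ≥ g p + ⟪s, u - p⟫ - ρ / 2 * ‖u - p‖ ^ 2` for all `u`, where `p` is the new iterate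
(`IsWeakSubgradient`, `isWeakSubgradient_of_mem_prox`). This single inequality replaces the
subdifferential calculus of weakly convex functions: it shows that `p` is a proximal point of
`p + γ • s` and that the Moreau envelope has gradient `s` there
(`IsWeakSubgradient.gradMoreau_eq`). The implicit Lipschitz property therefore bounds the difference
of two successive subgradients by the step in `x`.

*Descent.* Subtracting two successive optimality conditions expresses `Aᵀ` applied to the dual step
through the primal steps. The dual step lies in the range of `A`, where `Aᵀ` is bounded below by the
smallest positive eigenvalue of `Aᵀ A` (`sigmaMin_mul_norm_sq_le`). So the increase of the augmented
Lagrangian in the dual update is dominated by the decrease in the primal updates, and the Lyapunov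
function decreases by at least `a * ‖y (k + 1) - y k‖ ^ 2` (`Setting.exists_decrease`). Conversely it
has a subgradient at the `(k + 1)`-st iterate of norm at most `C * ‖y (k + 1) - y k‖`
(`Setting.exists_relative_error`).

*Limits.* The energies of a bounded sequence are bounded below, so they converge and the steps tend
to zero; the limit is the value of the Lyapunov function at the limit point
(`Setting.tendsto_energy`). The Kurdyka–Łojasiewicz inequality can then be used along the iterates
(`Setting.exists_kl_along_iterates`).

*Rates.* With `r k` the energy gap, the quantity `T k = ‖y (k + 1) - y k‖ + K * r (k + 1) ^ (1 - θ)`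
satisfies `‖y (k + 2) - y (k + 1)‖ ≤ T k - T (k + 1)` near the limit point, so the iterates stay
there and their distance to it is at most `T k` (`norm_sub_le_of_step_le_sub`). The rates follow from
the recursion `r (k + 1) + M * r (k + 1) ^ (2 * θ) ≤ r k` (`tendsto_and_rates_of_kl`).
-/

namespace LiMEAL

/-! ### Sequences governed by a Kurdyka–Łojasiewicz inequality -/

/-- Concavity of the desingularizing function `s ↦ s ^ (1 - θ)`: it lies below its tangents. -/
theorem rpow_one_sub_gap {s t θ : ℝ} (hs : 0 < s) (ht : 0 ≤ t) (hθ : 0 ≤ θ) (hθ' : θ < 1) :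
    (1 - θ) * s ^ (-θ) * (s - t) ≤ s ^ (1 - θ) - t ^ (1 - θ) := by
  have h1 : (t / s) ^ (1 - θ) ≤ 1 + (1 - θ) * (t / s - 1) := by
    have := _root_.rpow_one_add_le_one_add_mul_self (s := t / s - 1) (p := 1 - θ)
      (by linarith [div_nonneg ht hs.le]) (by linarith) (by linarith)
    simpa using this
  have h2 : s ^ (1 - θ) = s ^ (-θ) * s := by
    rw [show 1 - θ = -θ + 1 by ring, Real.rpow_add hs, Real.rpow_one]
  have h3 : t ^ (1 - θ) = (t / s) ^ (1 - θ) * s ^ (1 - θ) := by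
    rw [← Real.mul_rpow (div_nonneg ht hs.le) hs.le, div_mul_cancel₀ _ hs.ne']
  have h4 : t = t / s * s := by field_simp
  have h5 : 0 < s ^ (1 - θ) := Real.rpow_pos_of_pos hs _
  calc (1 - θ) * s ^ (-θ) * (s - t) = (1 - θ) * (1 - t / s) * (s ^ (-θ) * s) := by
        field_simp
    _ = s ^ (1 - θ) - (1 + (1 - θ) * (t / s - 1)) * s ^ (1 - θ) := by rw [← h2]; ring
    _ ≤ s ^ (1 - θ) - t ^ (1 - θ) := by rw [h3]; gcongr

section

variable {V : Type*} [NormedAddCommGroup V]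

/-- The one-step estimate behind the finite-length argument: with `d` and `d'` two consecutive step
lengths and `r`, `r'` the corresponding values, sufficient decrease and the Kurdyka–Łojasiewicz
inequality bound `d'` by the decrease of `d + K * r ^ (1 - θ)`. -/
theorem step_le_sub_of_kl {a C θ d d' r r' : ℝ} (ha : 0 < a) (hC : 0 < C) (hθ : 0 ≤ θ)
    (hθ' : θ < 1) (hd : 0 ≤ d) (hr : 0 < r) (hr' : 0 ≤ r')
    (hdec : a * d' ^ 2 ≤ r - r') (hkl : 1 ≤ C * r ^ (-θ) * d) :
    d' ≤ (d + C / (a * (1 - θ)) * r ^ (1 - θ)) - (d' + C / (a * (1 - θ)) * r' ^ (1 - θ)) := by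
  have hgap := rpow_one_sub_gap hr hr' hθ hθ'
  have hp : 0 < r ^ (-θ) := Real.rpow_pos_of_pos hr _
  have h1θ : 0 < 1 - θ := by linarith
  set δ := r ^ (1 - θ) - r' ^ (1 - θ) with hδ
  have hδ0 : 0 ≤ δ := le_trans (by
    have : 0 ≤ r - r' := le_trans (by positivity) hdec
    positivity) hgap
  have h1 : (1 - θ) * r ^ (-θ) * (a * d' ^ 2) ≤ δ :=
    le_trans (by gcongr) hgap
  have h2 : a * (1 - θ) * d' ^ 2 ≤ C * d * δ := by
    calc a * (1 - θ) * d' ^ 2 = (a * (1 - θ) * d' ^ 2) * 1 := by ring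
      _ ≤ (a * (1 - θ) * d' ^ 2) * (C * r ^ (-θ) * d) := by gcongr
      _ = C * d * ((1 - θ) * r ^ (-θ) * (a * d' ^ 2)) := by ring
      _ ≤ C * d * δ := by gcongr
  set K := C / (a * (1 - θ)) with hK
  have hK0 : 0 < K := by positivity
  have h3 : d' ^ 2 ≤ d * (K * δ) := by
    have : d * (K * δ) = (C * d * δ) / (a * (1 - θ)) := by rw [hK]; ring
    rw [this, le_div_iff₀ (by positivity)]
    linarith
  -- The arithmetic-geometric mean inequality turns the product into a sum.
  have h4 : (2 * d') ^ 2 ≤ (d + K * δ) ^ 2 := by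
    nlinarith [sq_nonneg (d - K * δ)]
  have h5 := abs_le_of_sq_le_sq' h4 (by positivity)
  have h6 : K * r ^ (1 - θ) - K * r' ^ (1 - θ) = K * δ := by rw [hδ]; ring
  linarith [h5.2]

/-- A sequence whose steps near the cluster point `ws` are bounded by the decrements of a
nonnegative null sequence `T` cannot leave a small ball around `ws` once it has come close enough,
and the distance to `ws` is then bounded by `T`. -/
theorem norm_sub_le_of_step_le_sub {w : ℕ → V} {ws : V} {T : ℕ → ℝ} {ε : ℝ} (hε : 0 < ε)
    (hT0 : ∀ k ≥ 1, 0 ≤ T k) (hT : Tendsto T atTop (𝓝 0)) {N : ℕ}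
    (hstep : ∀ k ≥ N, ‖w (k + 1) - ws‖ < ε → ‖w (k + 2) - w (k + 1)‖ ≤ T k - T (k + 1))
    (hcl : MapClusterPt ws atTop w) :
    ∃ N', ∀ k ≥ N', ‖w (k + 1) - ws‖ ≤ T k := by
  have hTs : ∀ᶠ k in atTop, T k < ε / 2 := hT.eventually (gt_mem_nhds (by linarith))
  have hfr : ∃ᶠ k in atTop, ‖w k - ws‖ < ε / 2 := by
    have := (mapClusterPt_iff_frequently.1 hcl) (Metric.ball ws (ε / 2))
      (Metric.ball_mem_nhds _ (by linarith))
    simpa [dist_eq_norm] using this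
  obtain ⟨N₁, hN₁⟩ := eventually_atTop.1 hTs
  obtain ⟨k₁, hk₁, hw₁⟩ := frequently_atTop.1 hfr (N + N₁ + 2)
  obtain ⟨M, rfl⟩ : ∃ M, k₁ = M + 1 := ⟨k₁ - 1, by omega⟩
  have hMT := hN₁ M (by omega)
  have hball : ∀ j, ‖w (M + j + 1) - w (M + 1)‖ ≤ T M - T (M + j) ∧
      ‖w (M + j + 1) - ws‖ < ε := by
    intro j
    induction j with
    | zero => simpa using lt_of_lt_of_le hw₁ (by linarith)
    | succ j ih =>
      have h1 := hstep (M + j) (by omega) ih.2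
      have h2 : ‖w (M + (j + 1) + 1) - w (M + 1)‖ ≤ T M - T (M + (j + 1)) := by
        have := norm_sub_le_norm_sub_add_norm_sub (w (M + j + 2)) (w (M + j + 1)) (w (M + 1))
        have e : M + (j + 1) = M + j + 1 := by ring
        rw [e]
        linarith [ih.1]
      refine ⟨h2, ?_⟩
      have := norm_sub_le_norm_sub_add_norm_sub (w (M + (j + 1) + 1)) (w (M + 1)) ws
      linarith [hT0 (M + (j + 1)) (by omega)]
  have hstep' : ∀ k ≥ M, ‖w (k + 2) - w (k + 1)‖ ≤ T k - T (k + 1) := by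
    intro k hk
    obtain ⟨j, rfl⟩ := Nat.exists_eq_add_of_le hk
    exact hstep _ (by omega) (hball j).2
  refine ⟨M, fun k hk => ?_⟩
  have htail : ∀ j, ‖w (k + j + 1) - w (k + 1)‖ ≤ T k - T (k + j) := by
    intro j
    induction j with
    | zero => simp
    | succ j ih =>
      have := norm_sub_le_norm_sub_add_norm_sub (w (k + j + 2)) (w (k + j + 1)) (w (k + 1))
      have h1 := hstep' (k + j) (by omega)
      have e : k + (j + 1) = k + j + 1 := by ring
      rw [e]
      linarith
  refine le_of_forall_pos_le_add fun δ hδ => ?_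
  have hfr' : ∃ᶠ k in atTop, ‖w k - ws‖ < δ := by
    have := (mapClusterPt_iff_frequently.1 hcl) (Metric.ball ws δ) (Metric.ball_mem_nhds _ hδ)
    simpa [dist_eq_norm] using this
  obtain ⟨i, hi, hwi⟩ := frequently_atTop.1 hfr' (k + 1)
  obtain ⟨j, rfl⟩ : ∃ j, i = k + j + 1 := ⟨i - k - 1, by omega⟩
  have h1 := norm_sub_le_norm_sub_add_norm_sub (w (k + 1)) (w (k + j + 1)) ws
  rw [norm_sub_rev (w (k + 1)) (w (k + j + 1))] at h1
  linarith [htail j, hT0 (k + j) (by omega)]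

/-- Geometric decay from a recursion `r (k + 1) + M * r (k + 1) ^ p ≤ r k` with `p ≤ 1`. -/
theorem linear_rate_of_recursion {r : ℕ → ℝ} {M p : ℝ} (hM : 0 < M) (hp' : p ≤ 1) {N : ℕ}
    (hpos : ∀ k ≥ N, 0 < r k) (hle : ∀ k ≥ N, r k ≤ 1)
    (hrec : ∀ k ≥ N, r (k + 1) + M * r (k + 1) ^ p ≤ r k) :
    ∃ c > 0, ∀ k ≥ N, r k ≤ c * ((1 + M)⁻¹) ^ k := by
  refine ⟨r N * (1 + M) ^ N, mul_pos (hpos N le_rfl) (by positivity), fun k hk => ?_⟩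
  induction k, hk using Nat.le_induction with
  | base => rw [mul_assoc, ← mul_pow, mul_inv_cancel₀ (by positivity)]; simp
  | succ k hk ih =>
    have h0 := hpos (k + 1) (by omega)
    have h1 : r (k + 1) ≤ r (k + 1) ^ p := by
      simpa using Real.rpow_le_rpow_of_exponent_ge h0 (hle (k + 1) (by omega)) hp'
    have h2 : r (k + 1) * (1 + M) ≤ r k := by
      have := hrec k hk
      nlinarith
    have h3 : r (k + 1) ≤ r k * (1 + M)⁻¹ := by
      rwa [← div_eq_mul_inv, le_div_iff₀ (by positivity)]
    calc r (k + 1) ≤ r k * (1 + M)⁻¹ := h3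
      _ ≤ (r N * (1 + M) ^ N * ((1 + M)⁻¹) ^ k) * (1 + M)⁻¹ := by gcongr
      _ = _ := by rw [pow_succ]; ring

/-- Sublinear decay from a recursion `r (k + 1) + M * r (k + 1) ^ (1 + q) ≤ r k` with
`0 < q ≤ 1`: Bernoulli's inequality shows that `r k ^ (-q)` grows at least linearly. -/
theorem sublinear_rate_of_recursion {r : ℕ → ℝ} {M q : ℝ} (hM : 0 < M) (hq : 0 < q)
    (hq' : q ≤ 1) {N : ℕ} (hpos : ∀ k ≥ N, 0 < r k) (hle : ∀ k ≥ N, r k ≤ 1)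
    (hrec : ∀ k ≥ N, r (k + 1) + M * r (k + 1) ^ (1 + q) ≤ r k) :
    ∃ c > 0, ∀ k ≥ N, (c * ((k : ℝ) - N)) ≤ r k ^ (-q) := by
  set c := q * M / (1 + M) with hc
  have hc0 : 0 < c := by positivity
  refine ⟨c, hc0, fun k hk => ?_⟩
  induction k, hk using Nat.le_induction with
  | base => simpa using (Real.rpow_pos_of_pos (hpos N le_rfl) _).le
  | succ k hk ih =>
    have hk0 := hpos k hk
    have h0 := hpos (k + 1) (by omega)
    set s := r (k + 1) with hs
    set t := s ^ q with ht
    have ht0 : 0 < t := Real.rpow_pos_of_pos h0 _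
    have ht1 : t ≤ 1 := Real.rpow_le_one h0.le (hle (k + 1) (by omega)) hq.le
    have hrk : s * (1 + M * t) ≤ r k := by
      have := hrec k hk
      rw [Real.rpow_add h0, Real.rpow_one] at this
      linarith
    have hb : (1 + M * t)⁻¹ ^ q ≤ 1 - q * (M * t / (1 + M * t)) := by
      have := _root_.rpow_one_add_le_one_add_mul_self (s := -(M * t / (1 + M * t))) (p := q)
        (by rw [neg_le_neg_iff, div_le_one (by positivity)]; linarith) hq.le hq'
      have e : 1 + -(M * t / (1 + M * t)) = (1 + M * t)⁻¹ := by field_simp; ring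
      rw [e] at this
      linarith
    have h1 : r k ^ (-q) ≤ t⁻¹ * (1 + M * t)⁻¹ ^ q := by
      calc r k ^ (-q) ≤ (s * (1 + M * t)) ^ (-q) :=
            Real.rpow_le_rpow_of_nonpos (by positivity) hrk (by linarith)
        _ = _ := by
            rw [Real.mul_rpow h0.le (by positivity), Real.rpow_neg h0.le,
              Real.rpow_neg (by positivity), Real.inv_rpow (by positivity)]
    have h2 : t⁻¹ * (1 + M * t)⁻¹ ^ q ≤ t⁻¹ - c := by
      calc t⁻¹ * (1 + M * t)⁻¹ ^ q ≤ t⁻¹ * (1 - q * (M * t / (1 + M * t))) := by gcongr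
        _ = t⁻¹ - q * M / (1 + M * t) := by field_simp
        _ ≤ t⁻¹ - c := by
            rw [hc]
            gcongr
            nlinarith
    have h3 : s ^ (-q) = t⁻¹ := Real.rpow_neg h0.le _
    rw [h3]
    push_cast
    linarith

/-- If the values `r k` are positive, the distances `‖w (k + 1) - ws‖` are eventually bounded by
`‖w (k + 1) - w k‖ + K * r (k + 1) ^ (1 - θ)`, hence by `B * r k ^ μ` whenever `μ` is at most `1 / 2`
and `1 - θ`. -/
theorem exists_norm_sub_le_rpow_of_kl {w : ℕ → V} {ws : V} {r : ℕ → ℝ} {a C θ ε : ℝ}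
    (ha : 0 < a) (hC : 0 < C) (hθ : 0 ≤ θ) (hθ' : θ < 1) (hε : 0 < ε)
    (hpos : ∀ k ≥ 1, 0 < r k)
    (hdec : ∀ k ≥ 1, a * ‖w (k + 1) - w k‖ ^ 2 ≤ r k - r (k + 1))
    (hr : Tendsto r atTop (𝓝 0))
    (hkl : ∀ᶠ k in atTop, ‖w (k + 1) - ws‖ < ε → 0 < r (k + 1) →
      1 ≤ C * r (k + 1) ^ (-θ) * ‖w (k + 1) - w k‖)
    (hcl : MapClusterPt ws atTop w) :
    ∃ B > 0, ∀ μ : ℝ, μ ≤ 1 / 2 → μ ≤ 1 - θ →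
      ∀ᶠ k in atTop, ‖w (k + 1) - ws‖ ≤ B * r k ^ μ := by
  have h1θ : 0 < 1 - θ := by linarith
  set K := C / (a * (1 - θ)) with hK
  have hK0 : 0 < K := by positivity
  obtain ⟨N, hN⟩ := eventually_atTop.1 hkl
  have hle : ∀ k ≥ 1, r (k + 1) ≤ r k := fun k hk => by
    have := hdec k hk
    nlinarith [sq_nonneg ‖w (k + 1) - w k‖]
  have hd : ∀ k ≥ 1, ‖w (k + 1) - w k‖ ≤ (1 / a) ^ (1 / 2 : ℝ) * r k ^ (1 / 2 : ℝ) := by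
    intro k hk
    have h0 := hpos k hk
    rw [← Real.mul_rpow (by positivity) h0.le, ← Real.sqrt_eq_rpow]
    apply Real.le_sqrt_of_sq_le
    rw [one_div_mul_eq_div, le_div_iff₀ ha]
    linarith [hdec k hk, hpos (k + 1) (by omega)]
  set T : ℕ → ℝ := fun k => ‖w (k + 1) - w k‖ + K * r (k + 1) ^ (1 - θ) with hTdef
  set A := (1 / a) ^ (1 / 2 : ℝ) with hA
  have hA0 : 0 < A := Real.rpow_pos_of_pos (by positivity) _
  have hTle : ∀ k ≥ 1, T k ≤ A * r k ^ (1 / 2 : ℝ) + K * r k ^ (1 - θ) := by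
    intro k hk
    have h1 := hd k hk
    have h2 : r (k + 1) ^ (1 - θ) ≤ r k ^ (1 - θ) :=
      Real.rpow_le_rpow (hpos _ (by omega)).le (hle k hk) h1θ.le
    simp only [hTdef]
    gcongr
  have hT0 : ∀ k ≥ 1, 0 ≤ T k := fun k _ => by
    have := hpos (k + 1) (by omega)
    simp only [hTdef]
    positivity
  have hrpow : ∀ p : ℝ, 0 < p → Tendsto (fun k => r k ^ p) atTop (𝓝 0) := fun p hp => by
    simpa [Real.zero_rpow hp.ne'] using hr.rpow_const (Or.inr hp.le)
  have hT : Tendsto T atTop (𝓝 0) := by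
    have hup : Tendsto (fun k => A * r k ^ (1 / 2 : ℝ) + K * r k ^ (1 - θ)) atTop (𝓝 0) := by
      simpa using ((hrpow _ (by norm_num)).const_mul A).add ((hrpow _ h1θ).const_mul K)
    refine tendsto_of_tendsto_of_tendsto_of_le_of_le' tendsto_const_nhds hup ?_ ?_
    · filter_upwards [eventually_ge_atTop 1] with k hk using hT0 k hk
    · filter_upwards [eventually_ge_atTop 1] with k hk using hTle k hk
  obtain ⟨N', hN'⟩ := norm_sub_le_of_step_le_sub (N := N + 1) hε hT0 hT (fun k hk hwk =>
    step_le_sub_of_kl ha hC hθ hθ' (norm_nonneg _) (hpos (k + 1) (by omega))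
      (hpos (k + 2) (by omega)).le (hdec (k + 1) (by omega))
      (hN k (by omega) hwk (hpos (k + 1) (by omega)))) hcl
  refine ⟨A + K, by positivity, fun μ h1 h2 => ?_⟩
  filter_upwards [eventually_ge_atTop (N' + 1), hr.eventually (gt_mem_nhds one_pos)] with k hk hk1
  have h0 := hpos k (by omega)
  have e1 : r k ^ (1 / 2 : ℝ) ≤ r k ^ μ := Real.rpow_le_rpow_of_exponent_ge h0 hk1.le h1
  have e2 : r k ^ (1 - θ) ≤ r k ^ μ := Real.rpow_le_rpow_of_exponent_ge h0 hk1.le h2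
  calc ‖w (k + 1) - ws‖ ≤ T k := hN' k (by omega)
    _ ≤ A * r k ^ (1 / 2 : ℝ) + K * r k ^ (1 - θ) := hTle k (by omega)
    _ ≤ A * r k ^ μ + K * r k ^ μ := by gcongr
    _ = _ := by ring

/-- Once the sequence is close to `ws`, sufficient decrease and the Kurdyka–Łojasiewicz inequality
combine to the recursion `r (k + 1) + M * r (k + 1) ^ (2 * θ) ≤ r k`. -/
theorem recursion_of_kl {w : ℕ → V} {r : ℕ → ℝ} {a C θ : ℝ} (ha : 0 < a) (hC : 0 < C)
    {k : ℕ} (hpos : 0 < r (k + 1))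
    (hdec : a * ‖w (k + 1) - w k‖ ^ 2 ≤ r k - r (k + 1))
    (hkl : 1 ≤ C * r (k + 1) ^ (-θ) * ‖w (k + 1) - w k‖) :
    r (k + 1) + a / C ^ 2 * r (k + 1) ^ (2 * θ) ≤ r k := by
  set s := r (k + 1) with hs
  set d := ‖w (k + 1) - w k‖ with hd
  have hsθ : 0 < s ^ θ := Real.rpow_pos_of_pos hpos _
  have h1 : s ^ θ ≤ C * d := by
    rw [Real.rpow_neg hpos.le] at hkl
    calc s ^ θ = s ^ θ * 1 := by ring
      _ ≤ s ^ θ * (C * (s ^ θ)⁻¹ * d) := by gcongr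
      _ = C * d := by field_simp
  have h2 : s ^ (2 * θ) = (s ^ θ) ^ 2 := by
    rw [mul_comm, Real.rpow_mul hpos.le, Real.rpow_ofNat]
  have h3 : (s ^ θ) ^ 2 ≤ (C * d) ^ 2 := by gcongr
  have h4 : a / C ^ 2 * s ^ (2 * θ) ≤ a * d ^ 2 := by
    calc a / C ^ 2 * s ^ (2 * θ) ≤ a / C ^ 2 * (C * d) ^ 2 := by rw [h2]; gcongr
      _ = a * d ^ 2 := by field_simp
  linarith

/-- Convergence and convergence rates of a descent sequence from sufficient decrease, a relative
error estimate combined with the Kurdyka–Łojasiewicz inequality near a cluster point `ws`, and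
convergence of the values. -/
theorem tendsto_and_rates_of_kl {w : ℕ → V} {ws : V} {r : ℕ → ℝ} {a C θ ε : ℝ}
    (ha : 0 < a) (hC : 0 < C) (hθ : 0 ≤ θ) (hθ' : θ < 1) (hε : 0 < ε)
    (hdec : ∀ k ≥ 1, a * ‖w (k + 1) - w k‖ ^ 2 ≤ r k - r (k + 1))
    (hr : Tendsto r atTop (𝓝 0))
    (hkl : ∀ᶠ k in atTop, ‖w (k + 1) - ws‖ < ε → 0 < r (k + 1) →
      1 ≤ C * r (k + 1) ^ (-θ) * ‖w (k + 1) - w k‖)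
    (hcl : MapClusterPt ws atTop w) :
    Tendsto w atTop (𝓝 ws) ∧
    (θ = 0 → ∃ k₀ : ℕ, ∀ k ≥ k₀, w k = ws) ∧
    (0 < θ → θ ≤ 1 / 2 → ∃ k₀ : ℕ, 0 < k₀ ∧ ∃ c : ℝ, 0 < c ∧ ∃ τ : ℝ, 0 < τ ∧ τ < 1 ∧
      ∀ k ≥ k₀, ‖w k - ws‖ ≤ c * τ ^ k) ∧
    (1 / 2 < θ → ∃ k₀ : ℕ, 0 < k₀ ∧ ∃ c : ℝ, 0 < c ∧
      ∀ k ≥ k₀, ‖w k - ws‖ ≤ c * (k : ℝ) ^ (-((1 - θ) / (2 * θ - 1)))) := by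
  have hle : ∀ k ≥ 1, r (k + 1) ≤ r k := fun k hk => by
    have := hdec k hk
    nlinarith [sq_nonneg ‖w (k + 1) - w k‖]
  have hanti : ∀ k ≥ 1, ∀ l ≥ k, r l ≤ r k := fun k hk l hl => by
    induction l, hl using Nat.le_induction with
    | base => exact le_rfl
    | succ l hl ih => exact (hle l (by omega)).trans ih
  have hnn : ∀ k ≥ 1, 0 ≤ r k := fun k hk =>
    le_of_tendsto hr (by filter_upwards [eventually_ge_atTop k] with l hl using hanti k hk l hl)
  by_cases hz : ∃ k ≥ 1, r k = 0
  · -- The values reach their limit after finitely many steps, and the sequence stops moving.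
    obtain ⟨K, hK, hrK⟩ := hz
    have hr0 : ∀ k ≥ K, r k = 0 := fun k hk =>
      le_antisymm (hrK ▸ hanti K hK k hk) (hnn k (by omega))
    have hconst : ∀ k ≥ K, w k = w K := fun k hk => by
      induction k, hk using Nat.le_induction with
      | base => rfl
      | succ k hk ih =>
        have h1 := hdec k (by omega)
        rw [hr0 k hk, hr0 (k + 1) (by omega), sub_zero] at h1
        have h2 : ‖w (k + 1) - w k‖ ^ 2 ≤ 0 := by
          by_contra hcon
          push Not at hcon
          nlinarith [mul_pos ha hcon]
        have h3 : ‖w (k + 1) - w k‖ = 0 :=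
          pow_eq_zero_iff (two_ne_zero) |>.1 (le_antisymm h2 (sq_nonneg _))
        rw [← ih]
        exact sub_eq_zero.1 (norm_eq_zero.1 h3)
    have hlim : Tendsto w atTop (𝓝 (w K)) := tendsto_const_nhds.congr' (by
      filter_upwards [eventually_ge_atTop K] with k hk using (hconst k hk).symm)
    have hws : w K = ws := by
      by_contra hne
      have hδ : 0 < ‖w K - ws‖ := norm_pos_iff.2 (sub_ne_zero.2 hne)
      have := (mapClusterPt_iff_frequently.1 hcl) _ (Metric.ball_mem_nhds ws hδ)
      obtain ⟨k, hk, hk'⟩ := frequently_atTop.1 this K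
      rw [Metric.mem_ball, dist_eq_norm, hconst k hk] at hk'
      exact lt_irrefl _ hk'
    have heq : ∀ k ≥ K, w k = ws := fun k hk => (hconst k hk).trans hws
    refine ⟨hws ▸ hlim, fun _ => ⟨K, heq⟩, fun _ _ => ⟨K, hK, 1, one_pos, 1 / 2, by norm_num,
      by norm_num, fun k hk => ?_⟩, fun _ => ⟨K, hK, 1, one_pos, fun k hk => ?_⟩⟩
    · rw [heq k hk, sub_self, norm_zero]; positivity
    · rw [heq k hk, sub_self, norm_zero]; positivity
  push Not at hz
  have hpos : ∀ k ≥ 1, 0 < r k := fun k hk => lt_of_le_of_ne (hnn k hk) (hz k hk).symm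
  obtain ⟨B, hB, hbound⟩ := exists_norm_sub_le_rpow_of_kl ha hC hθ hθ' hε hpos hdec hr hkl hcl
  have hrpow : ∀ p : ℝ, 0 < p → Tendsto (fun k => r k ^ p) atTop (𝓝 0) := fun p hp => by
    simpa [Real.zero_rpow hp.ne'] using hr.rpow_const (Or.inr hp.le)
  have hconv : Tendsto w atTop (𝓝 ws) := by
    rw [← tendsto_add_atTop_iff_nat 1, tendsto_iff_norm_sub_tendsto_zero]
    have hμ : 0 < min (1 / 2) (1 - θ) := lt_min (by norm_num) (by linarith)
    refine tendsto_of_tendsto_of_tendsto_of_le_of_le' tendsto_const_nhds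
      (by simpa using (hrpow _ hμ).const_mul B) (Eventually.of_forall fun k => norm_nonneg _)
      (hbound _ (min_le_left _ _) (min_le_right _ _))
  have hkl' : ∀ᶠ k in atTop, 1 ≤ C * r (k + 1) ^ (-θ) * ‖w (k + 1) - w k‖ := by
    have hnear : ∀ᶠ k in atTop, ‖w (k + 1) - ws‖ < ε := by
      have := (tendsto_iff_norm_sub_tendsto_zero.1 hconv).comp (tendsto_add_atTop_nat 1)
      exact this.eventually (gt_mem_nhds hε)
    filter_upwards [hkl, hnear] with k h1 h2 using h1 h2 (hpos (k + 1) (by omega))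
  have hrec : ∃ N ≥ 1, ∀ k ≥ N, r k ≤ 1 ∧
      r (k + 1) + a / C ^ 2 * r (k + 1) ^ (2 * θ) ≤ r k := by
    have : ∀ᶠ k in atTop, r k ≤ 1 ∧ r (k + 1) + a / C ^ 2 * r (k + 1) ^ (2 * θ) ≤ r k := by
      filter_upwards [hkl', eventually_ge_atTop 1, hr.eventually (gt_mem_nhds one_pos)]
        with k h1 h2 h3
      exact ⟨h3.le, recursion_of_kl ha hC (hpos (k + 1) (by omega)) (hdec k h2) h1⟩
    obtain ⟨N, hN⟩ := eventually_atTop.1 this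
    exact ⟨N + 1, by omega, fun k hk => hN k (by omega)⟩
  obtain ⟨N, hN1, hN⟩ := hrec
  have hM : 0 < a / C ^ 2 := by positivity
  refine ⟨hconv, fun h0 => ?_, fun hθ0 hθ2 => ?_, fun hθ2 => ?_⟩
  · -- For `θ = 0` the inequality keeps the steps away from zero, although the sequence converges.
    exfalso
    subst h0
    have hsteps : Tendsto (fun k => C * ‖w (k + 1) - w k‖) atTop (𝓝 0) := by
      have := ((hconv.comp (tendsto_add_atTop_nat 1)).sub hconv).norm.const_mul C
      simpa using this
    have hlt := hsteps.eventually (gt_mem_nhds one_pos)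
    obtain ⟨k, h1, h2⟩ := (hkl'.and hlt).exists
    simp only [neg_zero, Real.rpow_zero, mul_one] at h1
    linarith
  · obtain ⟨c, hc, hrate⟩ := linear_rate_of_recursion (p := 2 * θ) hM (by linarith)
      (fun k hk => hpos k (by omega)) (fun k hk => (hN k hk).1) (fun k hk => (hN k hk).2)
    obtain ⟨N', hN'⟩ := eventually_atTop.1 (hbound (1 / 2) le_rfl (by linarith))
    set q := (1 + a / C ^ 2)⁻¹ with hq
    have hq0 : 0 < q := by positivity
    have hq1 : q < 1 := inv_lt_one_of_one_lt₀ (by linarith)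
    set τ := q ^ (1 / 2 : ℝ) with hτ
    have hτ0 : 0 < τ := Real.rpow_pos_of_pos hq0 _
    have hτ1 : τ < 1 := Real.rpow_lt_one hq0.le hq1 (by norm_num)
    refine ⟨N + N' + 1, by omega, B * c ^ (1 / 2 : ℝ) / τ,
      div_pos (mul_pos hB (Real.rpow_pos_of_pos hc _)) hτ0, τ, hτ0, hτ1, fun k hk => ?_⟩
    obtain ⟨j, rfl⟩ : ∃ j, k = j + 1 := ⟨k - 1, by omega⟩
    have h1 := hrate j (by omega)
    have h2 : r j ^ (1 / 2 : ℝ) ≤ c ^ (1 / 2 : ℝ) * τ ^ j := by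
      calc r j ^ (1 / 2 : ℝ) ≤ (c * q ^ j) ^ (1 / 2 : ℝ) :=
            Real.rpow_le_rpow (hpos j (by omega)).le h1 (by norm_num)
        _ = c ^ (1 / 2 : ℝ) * τ ^ j := by
            rw [Real.mul_rpow hc.le (by positivity), hτ, ← Real.rpow_natCast,
              ← Real.rpow_natCast, ← Real.rpow_mul hq0.le, ← Real.rpow_mul hq0.le, mul_comm (j : ℝ)]
    calc ‖w (j + 1) - ws‖ ≤ B * r j ^ (1 / 2 : ℝ) := hN' j (by omega)
      _ ≤ B * (c ^ (1 / 2 : ℝ) * τ ^ j) := by gcongr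
      _ = _ := by rw [pow_succ]; field_simp
  · have hq0 : 0 < 2 * θ - 1 := by linarith
    obtain ⟨c, hc, hrate⟩ := sublinear_rate_of_recursion (q := 2 * θ - 1) hM hq0 (by linarith)
      (fun k hk => hpos k (by omega)) (fun k hk => (hN k hk).1)
      (fun k hk => by rw [show 1 + (2 * θ - 1) = 2 * θ by ring]; exact (hN k hk).2)
    obtain ⟨N', hN'⟩ := eventually_atTop.1
      (hbound (1 - θ) (by linarith) le_rfl)
    set p := (1 - θ) / (2 * θ - 1) with hp
    have hp0 : 0 < p := div_pos (by linarith) hq0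
    refine ⟨2 * N + N' + 2, by omega, B * (c / 2) ^ (-p),
      mul_pos hB (Real.rpow_pos_of_pos (by linarith) _), fun k hk => ?_⟩
    obtain ⟨j, rfl⟩ : ∃ j, k = j + 1 := ⟨k - 1, by omega⟩
    have hj := hpos j (by omega)
    -- Past `2 * N + 2` the shifted index `j - N` is at least half of `j + 1`.
    have hjN : (2 * N + 1 : ℝ) ≤ j := by exact_mod_cast (by omega : 2 * N + 1 ≤ j)
    have h1 : c / 2 * ((j + 1 : ℕ) : ℝ) ≤ r j ^ (-(2 * θ - 1)) := by
      refine le_trans ?_ (hrate j (by omega))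
      push_cast
      nlinarith
    have h2 : r j ^ (1 - θ) ≤ (c / 2 * ((j + 1 : ℕ) : ℝ)) ^ (-p) := by
      have e : r j ^ (1 - θ) = (r j ^ (-(2 * θ - 1))) ^ (-p) := by
        rw [← Real.rpow_mul hj.le, hp]
        congr 1
        rw [neg_mul_neg, mul_div_assoc', mul_div_cancel_left₀ _ hq0.ne']
      rw [e]
      exact Real.rpow_le_rpow_of_nonpos (by positivity) h1 (by linarith)
    calc ‖w (j + 1) - ws‖ ≤ B * r j ^ (1 - θ) := hN' j (by omega)
      _ ≤ B * (c / 2 * ((j + 1 : ℕ) : ℝ)) ^ (-p) := by gcongr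
      _ = _ := by rw [Real.mul_rpow (by linarith) (by positivity)]; ring

end

/-! ### Weak subgradients, proximal points and Moreau envelopes -/

section

variable {E : Type*} [NormedAddCommGroup E] [InnerProductSpace ℝ E]

/-- `s` is a global subgradient of `g` at `p` up to the quadratic error `ρ / 2 * ‖u - p‖ ^ 2`, and
`g p` is finite. For a `ρ`-weakly convex function this describes its limiting subgradients. -/
def IsWeakSubgradient (ρ : ℝ) (g : E → EReal) (p s : E) : Prop :=
  ((g p).toReal : EReal) = g p ∧
    ∀ u, (((g p).toReal + inner ℝ s (u - p) - ρ / 2 * ‖u - p‖ ^ 2 : ℝ) : EReal) ≤ g u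

theorem IsWeakSubgradient.le_toReal {ρ : ℝ} {g : E → EReal} {p s u : E}
    (hs : IsWeakSubgradient ρ g p s) (hu : ((g u).toReal : EReal) = g u) :
    (g p).toReal + inner ℝ s (u - p) - ρ / 2 * ‖u - p‖ ^ 2 ≤ (g u).toReal := by
  have := hs.2 u
  rw [← hu] at this
  exact_mod_cast this

/-- Weak convexity as an inequality along segments. -/
theorem WeaklyConvex.segment_le {ρ : ℝ} {g : E → EReal} (hg : WeaklyConvex ρ g)
    (hbot : ∀ x, g x ≠ ⊥) {p u : E} {cp cu t : ℝ} (hp : g p = cp) (hu : g u = cu)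
    (ht0 : 0 ≤ t) (ht1 : t ≤ 1) :
    ∃ ct : ℝ, g (p + t • (u - p)) = ct ∧
      ct ≤ cp + t * (cu - cp) + ρ / 2 * (t * (1 - t) * ‖u - p‖ ^ 2) := by
  have hmp : ((p, cp + ρ / 2 * ‖p‖ ^ 2) : E × ℝ) ∈
      {q : E × ℝ | g q.1 + ((ρ / 2 * ‖q.1‖ ^ 2 : ℝ) : EReal) ≤ (q.2 : EReal)} := by
    simp [hp]
  have hmu : ((u, cu + ρ / 2 * ‖u‖ ^ 2) : E × ℝ) ∈
      {q : E × ℝ | g q.1 + ((ρ / 2 * ‖q.1‖ ^ 2 : ℝ) : EReal) ≤ (q.2 : EReal)} := by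
    simp [hu]
  have hmem := hg hmp hmu (sub_nonneg.2 ht1) ht0 (by ring)
  have hpt : (1 - t) • p + t • u = p + t • (u - p) := by
    rw [sub_smul, one_smul, smul_sub]; abel
  simp only [Prod.smul_mk, Prod.mk_add_mk, Set.mem_ofPred_eq, hpt, smul_eq_mul] at hmem
  have htop : g (p + t • (u - p)) ≠ ⊤ := by
    intro htop
    rw [htop, EReal.top_add_coe] at hmem
    exact absurd hmem (not_le.2 (EReal.coe_lt_top _))
  refine ⟨(g (p + t • (u - p))).toReal, (EReal.coe_toReal htop (hbot _)).symm, ?_⟩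
  rw [← EReal.coe_toReal htop (hbot _), ← EReal.coe_add, EReal.coe_le_coe_iff] at hmem
  have hpu : ‖p + t • (u - p)‖ ^ 2
      = (1 - t) * ‖p‖ ^ 2 + t * ‖u‖ ^ 2 - t * (1 - t) * ‖u - p‖ ^ 2 := by
    rw [← hpt, norm_add_sq_real, norm_sub_sq_real, norm_smul, norm_smul, inner_smul_left,
      inner_smul_right, mul_pow, mul_pow, real_inner_comm]
    simp only [Real.norm_eq_abs, sq_abs, conj_trivial]
    ring
  rw [hpu] at hmem
  linarith

/-- First-order optimality: if `p` minimizes `g + q` with `g` weakly convex and `q` differentiable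
at `p` along segments with gradient `d`, then `-d` is a weak subgradient of `g` at `p`. -/
theorem WeaklyConvex.isWeakSubgradient_neg {ρ : ℝ} {g : E → EReal} (hg : WeaklyConvex ρ g)
    (hbot : ∀ x, g x ≠ ⊥) {p d : E} {q : E → ℝ} (hp : g p ≠ ⊤)
    (hmin : ∀ u, g p + (q p : EReal) ≤ g u + (q u : EReal))
    (hq : ∀ u, ∃ K : ℝ, ∀ t, 0 < t → t ≤ 1 →
      q (p + t • (u - p)) ≤ q p + t * inner ℝ d (u - p) + t ^ 2 * K) :
    IsWeakSubgradient ρ g p (-d) := by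
  have hpc := EReal.coe_toReal hp (hbot p)
  refine ⟨hpc, fun u => ?_⟩
  by_cases hu : g u = ⊤
  · rw [hu]; exact le_top
  have huc := EReal.coe_toReal hu (hbot u)
  rw [← huc, EReal.coe_le_coe_iff]
  set cp := (g p).toReal
  set cu := (g u).toReal
  obtain ⟨K, hK⟩ := hq u
  -- The inequality along the segment, divided by `t`.
  have key : ∀ t, 0 < t → t ≤ 1 →
      0 ≤ cu - cp + inner ℝ d (u - p) + ρ / 2 * ((1 - t) * ‖u - p‖ ^ 2) + t * K := by
    intro t ht0 ht1
    obtain ⟨ct, hct, hle⟩ := hg.segment_le hbot hpc.symm huc.symm ht0.le ht1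
    have h1 := hmin (p + t • (u - p))
    rw [← hpc, hct, ← EReal.coe_add, ← EReal.coe_add, EReal.coe_le_coe_iff] at h1
    have h2 := hK t ht0 ht1
    have h3 : 0 ≤ t * (cu - cp + inner ℝ d (u - p) + ρ / 2 * ((1 - t) * ‖u - p‖ ^ 2) + t * K) := by
      nlinarith
    exact nonneg_of_mul_nonneg_right h3 ht0
  have hlim : Tendsto (fun t : ℝ => cu - cp + inner ℝ d (u - p)
      + ρ / 2 * ((1 - t) * ‖u - p‖ ^ 2) + t * K) (𝓝[>] 0)
      (𝓝 (cu - cp + inner ℝ d (u - p) + ρ / 2 * ((1 - 0) * ‖u - p‖ ^ 2) + 0 * K)) :=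
    (Continuous.tendsto (by fun_prop) 0).mono_left nhdsWithin_le_nhds
  have h0 := ge_of_tendsto hlim (by
    filter_upwards [Ioc_mem_nhdsGT (zero_lt_one' ℝ)] with t ht using key t ht.1 ht.2)
  rw [inner_neg_left]
  linarith

/-- The expansion of the proximal objective around the point `p + γ • s`. -/
theorem norm_sub_add_smul_sq_div {γ : ℝ} (hγ : 0 < γ) (p s δ u : E) :
    ‖u - (p + γ • s + δ)‖ ^ 2 / (2 * γ) = ‖u - p‖ ^ 2 / (2 * γ) - inner ℝ s (u - p)
      - inner ℝ (u - p) δ / γ + γ / 2 * ‖s‖ ^ 2 + inner ℝ s δ + ‖δ‖ ^ 2 / (2 * γ) := by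
  rw [show u - (p + γ • s + δ) = (u - p) - (γ • s + δ) by abel, norm_sub_sq_real,
    norm_add_sq_real, inner_add_right, inner_smul_right, inner_smul_left, norm_smul, mul_pow,
    real_inner_comm s]
  simp only [Real.norm_eq_abs, sq_abs, conj_trivial]
  field_simp
  ring

/-- Lower bound for the proximal objective at a perturbation of `p + γ • s`. -/
theorem IsWeakSubgradient.proxObjective_ge {ρ γ : ℝ} {g : E → EReal} {p s : E}
    (hs : IsWeakSubgradient ρ g p s) (hγ : 0 < γ) (hργ : ρ < 1 / γ) (u δ : E) :
    (((g p).toReal + γ / 2 * ‖s‖ ^ 2 + inner ℝ s δ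
      - 1 / (2 * γ ^ 2 * (1 / γ - ρ)) * ‖δ‖ ^ 2 : ℝ) : EReal)
      ≤ g u + ((‖u - (p + γ • s + δ)‖ ^ 2 / (2 * γ) : ℝ) : EReal) := by
  refine le_trans ?_ (add_le_add_left (hs.2 u) _)
  rw [← EReal.coe_add, EReal.coe_le_coe_iff, norm_sub_add_smul_sq_div hγ]
  have hμ : 0 < 1 / γ - ρ := by linarith
  set μ := 1 / γ - ρ with hμdef
  have h1 : inner ℝ (u - p) δ ≤ ‖u - p‖ * ‖δ‖ := real_inner_le_norm _ _
  have h2 : inner ℝ (u - p) δ / γ ≤ ‖u - p‖ * ‖δ‖ / γ := by gcongr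
  have h3 : 0 ≤ μ / 2 * (‖u - p‖ - ‖δ‖ / (γ * μ)) ^ 2 := by positivity
  have h4 : μ / 2 * (‖u - p‖ - ‖δ‖ / (γ * μ)) ^ 2 = μ / 2 * ‖u - p‖ ^ 2 - ‖u - p‖ * ‖δ‖ / γ
      + 1 / (2 * γ ^ 2 * μ) * ‖δ‖ ^ 2 := by
    field_simp
    ring
  have h5 : ‖u - p‖ ^ 2 / (2 * γ) - ρ / 2 * ‖u - p‖ ^ 2 = μ / 2 * ‖u - p‖ ^ 2 := by
    rw [hμdef]; field_simp
  have h6 : 0 ≤ ‖δ‖ ^ 2 / (2 * γ) := by positivity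
  linarith

/-- A weak subgradient `s` at `p` exhibits `p` as a proximal point of `p + γ • s`. -/
theorem IsWeakSubgradient.mem_prox {ρ γ : ℝ} {g : E → EReal} {p s : E}
    (hs : IsWeakSubgradient ρ g p s) (hγ : 0 < γ) (hργ : ρ < 1 / γ) :
    p ∈ Prox γ g (p + γ • s) := by
  intro u
  have h1 := hs.proxObjective_ge hγ hργ u 0
  have h2 := norm_sub_add_smul_sq_div hγ p s 0 p
  simp only [add_zero, inner_zero_right, norm_zero, sub_self, ne_eq, OfNat.ofNat_ne_zero,
    not_false_eq_true, zero_pow, mul_zero, sub_zero, zero_div, zero_add] at h1 h2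
  rw [h2, ← hs.1]
  exact_mod_cast h1

theorem hasFDerivAt_of_abs_sub_le_sq {F : E → ℝ} {ℓ : E →L[ℝ] ℝ} {w : E} {K : ℝ}
    (hF : ∀ δ, |F (w + δ) - F w - ℓ δ| ≤ K * ‖δ‖ ^ 2) : HasFDerivAt F ℓ w := by
  rw [hasFDerivAt_iff_isLittleO_nhds_zero]
  have h1 : (fun δ : E => F (w + δ) - F w - ℓ δ) =O[𝓝 0] fun δ => ‖δ‖ ^ 2 :=
    Asymptotics.IsBigO.of_bound K (Eventually.of_forall fun δ => by simpa using hF δ)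
  exact h1.trans_isLittleO (Asymptotics.isLittleO_norm_pow_id one_lt_two)

/-- The Moreau envelope has gradient `s` at `p + γ • s` for every weak subgradient `s` at `p`:
around this point it is squeezed between two paraboloids. -/
theorem IsWeakSubgradient.gradMoreau_eq [CompleteSpace E] {ρ γ : ℝ} {g : E → EReal} {p s : E}
    (hs : IsWeakSubgradient ρ g p s) (hγ : 0 < γ) (hργ : ρ < 1 / γ) :
    gradMoreau γ g (p + γ • s) = s := by
  set c := (g p).toReal + γ / 2 * ‖s‖ ^ 2 with hc
  set K := 1 / (2 * γ ^ 2 * (1 / γ - ρ)) with hK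
  have hlow : ∀ δ, ((c + inner ℝ s δ - K * ‖δ‖ ^ 2 : ℝ) : EReal)
      ≤ moreauEnvelope γ g (p + γ • s + δ) := fun δ =>
    le_iInf fun u => hs.proxObjective_ge hγ hργ u δ
  have hup : ∀ δ, moreauEnvelope γ g (p + γ • s + δ)
      ≤ ((c + inner ℝ s δ + 1 / (2 * γ) * ‖δ‖ ^ 2 : ℝ) : EReal) := fun δ => by
    refine (iInf_le _ p).trans ?_
    rw [norm_sub_add_smul_sq_div hγ, ← hs.1, ← EReal.coe_add, EReal.coe_le_coe_iff]
    simp only [sub_self, norm_zero, inner_zero_left, inner_zero_right, hc]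
    apply le_of_eq
    ring
  have hfin : ∀ δ, ((moreauEnvelope γ g (p + γ • s + δ)).toReal : EReal)
      = moreauEnvelope γ g (p + γ • s + δ) := fun δ =>
    EReal.coe_toReal (ne_top_of_le_ne_top (EReal.coe_ne_top _) (hup δ))
      (ne_bot_of_le_ne_bot (EReal.coe_ne_bot _) (hlow δ))
  have hlow' : ∀ δ, c + inner ℝ s δ - K * ‖δ‖ ^ 2
      ≤ (moreauEnvelope γ g (p + γ • s + δ)).toReal := fun δ => by
    rw [← EReal.coe_le_coe_iff, hfin]; exact hlow δ
  have hup' : ∀ δ, (moreauEnvelope γ g (p + γ • s + δ)).toReal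
      ≤ c + inner ℝ s δ + 1 / (2 * γ) * ‖δ‖ ^ 2 := fun δ => by
    rw [← EReal.coe_le_coe_iff, hfin]; exact hup δ
  have hc0 : (moreauEnvelope γ g (p + γ • s)).toReal = c := by
    have h1 := hlow' 0
    have h2 := hup' 0
    simp only [add_zero, inner_zero_right, norm_zero, ne_eq, OfNat.ofNat_ne_zero,
      not_false_eq_true, zero_pow, mul_zero, sub_zero] at h1 h2
    exact le_antisymm h2 h1
  have hgrad : HasGradientAt (fun w => (moreauEnvelope γ g w).toReal) s (p + γ • s) := by
    refine hasFDerivAt_of_abs_sub_le_sq (K := K + 1 / (2 * γ)) fun δ => ?_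
    have hK0 : 0 ≤ K * ‖δ‖ ^ 2 := by
      have : 0 < 1 / γ - ρ := by linarith
      positivity
    have hγ0 : 0 ≤ 1 / (2 * γ) * ‖δ‖ ^ 2 := by positivity
    have h1 := hlow' δ
    have h2 := hup' δ
    simp only [hc0, InnerProductSpace.toDual_apply_apply]
    rw [abs_le]
    constructor <;> linarith
  exact hgrad.gradient

theorem IsWeakSubgradient.mem_frechetSubdiff {ρ : ℝ} {φ : E → EReal} {y v : E}
    (hv : IsWeakSubgradient ρ φ y v) : v ∈ frechetSubdiff φ y := by
  refine ⟨by rw [← hv.1]; exact EReal.coe_ne_top _, fun ε hε => ?_⟩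
  have hlim : Tendsto (fun u => ρ / 2 * ‖u - y‖) (𝓝 y) (𝓝 0) := by
    have : Continuous fun u => ρ / 2 * ‖u - y‖ := by fun_prop
    simpa using this.tendsto y
  filter_upwards [hlim.eventually (gt_mem_nhds hε)] with u hu
  refine le_trans ?_ (hv.2 u)
  rw [← hv.1, ← EReal.coe_add, EReal.toReal_coe, EReal.coe_le_coe_iff]
  nlinarith [norm_nonneg (u - y)]

theorem frechetSubdiff_subset_limitingSubdiff (φ : E → EReal) (y : E) :
    frechetSubdiff φ y ⊆ limitingSubdiff φ y := fun v hv =>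
  ⟨hv.1, fun _ => y, fun _ => v, tendsto_const_nhds, tendsto_const_nhds, fun _ => hv,
    tendsto_const_nhds⟩

/-- The two-sided quadratic bound for a function with Lipschitz continuous gradient. -/
theorem abs_sub_sub_inner_gradient_le [CompleteSpace E] {h : E → ℝ} {L : ℝ}
    (hdiff : Differentiable ℝ h)
    (hlip : ∀ u v : E, ‖gradient h u - gradient h v‖ ≤ L * ‖u - v‖) (p u : E) :
    |h u - h p - inner ℝ (gradient h p) (u - p)| ≤ L / 2 * ‖u - p‖ ^ 2 := by
  set v := u - p with hv
  have hder : ∀ t : ℝ, HasDerivAt (fun t : ℝ => h (p + t • v))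
      (inner ℝ (gradient h (p + t • v)) v) t := by
    intro t
    have h1 : HasDerivAt (fun t : ℝ => p + t • v) v t := by
      simpa using ((hasDerivAt_id t).smul_const v).const_add p
    exact (hdiff (p + t • v)).hasGradientAt.hasFDerivAt.comp_hasDerivAt t h1
  have hbound : ∀ t : ℝ, 0 ≤ t →
      |inner ℝ (gradient h (p + t • v)) v - inner ℝ (gradient h p) v| ≤ L * t * ‖v‖ ^ 2 := by
    intro t ht
    rw [← inner_sub_left]
    refine (abs_real_inner_le_norm _ _).trans ?_
    have := hlip (p + t • v) p
    rw [add_sub_cancel_left, norm_smul, Real.norm_of_nonneg ht] at this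
    nlinarith [norm_nonneg v]
  -- Compare `t ↦ h (p + t • v)` with its quadratic upper and lower models on `[0, 1]`.
  have aux : ∀ σ : ℝ, σ = 1 ∨ σ = -1 →
      σ * (h (p + v) - h p - inner ℝ (gradient h p) v) ≤ L / 2 * ‖v‖ ^ 2 := by
    intro σ hσ
    have hd : ∀ t : ℝ, HasDerivAt (fun t : ℝ => σ * (h (p + t • v) - t * inner ℝ (gradient h p) v)
        - L / 2 * t ^ 2 * ‖v‖ ^ 2)
        (σ * (inner ℝ (gradient h (p + t • v)) v - inner ℝ (gradient h p) v)
          - L * t * ‖v‖ ^ 2) t := by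
      intro t
      have h1 := (((hder t).sub ((hasDerivAt_id t).mul_const
        (inner ℝ (gradient h p) v))).const_mul σ).sub
        ((((hasDerivAt_id t).pow 2).const_mul (L / 2)).mul_const (‖v‖ ^ 2))
      refine h1.congr_deriv ?_
      simp only [id, Nat.cast_ofNat, Nat.reduceSub, pow_one]
      ring
    have hanti : AntitoneOn (fun t : ℝ => σ * (h (p + t • v) - t * inner ℝ (gradient h p) v)
        - L / 2 * t ^ 2 * ‖v‖ ^ 2) (Set.Icc 0 1) := by
      refine antitoneOn_of_deriv_nonpos (convex_Icc 0 1)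
        (fun t _ => (hd t).continuousAt.continuousWithinAt)
        (fun t _ => (hd t).differentiableAt.differentiableWithinAt) fun t ht => ?_
      rw [interior_Icc] at ht
      rw [(hd t).deriv]
      have := abs_le.1 (hbound t ht.1.le)
      rcases hσ with rfl | rfl <;> linarith
    have := hanti (Set.left_mem_Icc.2 zero_le_one) (Set.right_mem_Icc.2 zero_le_one) zero_le_one
    simp only [one_smul, zero_smul, add_zero, one_mul, zero_mul, sub_zero, one_pow, mul_one,
      ne_eq, OfNat.ofNat_ne_zero, not_false_eq_true, zero_pow, mul_zero] at this
    linarith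
  have hu : p + v = u := by rw [hv]; abel
  rw [← hu, abs_le]
  constructor
  · linarith [aux (-1) (Or.inr rfl)]
  · linarith [aux 1 (Or.inl rfl)]

end

/-! ### The smallest positive eigenvalue -/

theorem sigmaMin_nonneg {n m : ℕ} (A : Matrix (Fin m) (Fin n) ℝ) : 0 ≤ sigmaMin A :=
  Real.sInf_nonneg fun _ hμ => hμ.1.le

/-- On the range of `A`, the adjoint is bounded below by the smallest positive eigenvalue of
`Aᵀ A`. -/
theorem sigmaMin_mul_norm_sq_le {n m : ℕ} (A : Matrix (Fin m) (Fin n) ℝ) (v : Vec n) :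
    sigmaMin A * ‖A.toEuclideanLin v‖ ^ 2
      ≤ ‖LinearMap.adjoint A.toEuclideanLin (A.toEuclideanLin v)‖ ^ 2 := by
  set T := A.toEuclideanLin with hT
  set S : Vec n →ₗ[ℝ] Vec n := LinearMap.adjoint T ∘ₗ T with hS
  have hsym : S.IsSymmetric := fun x y => by
    rw [hS, LinearMap.comp_apply, LinearMap.comp_apply, LinearMap.adjoint_inner_left,
      LinearMap.adjoint_inner_right]
  have hfr : Module.finrank ℝ (Vec n) = n := finrank_euclideanSpace_fin
  obtain ⟨e, μ, heig⟩ : ∃ (e : OrthonormalBasis (Fin n) ℝ (Vec n)) (μ : Fin n → ℝ),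
      ∀ i, S (e i) = μ i • e i :=
    ⟨hsym.eigenvectorBasis hfr, hsym.eigenvalues hfr, hsym.apply_eigenvectorBasis hfr⟩
  have hσ : ∀ i, μ i = 0 ∨ sigmaMin A ≤ μ i := by
    intro i
    have hμi : 0 ≤ μ i := by
      have h1 : inner ℝ (S (e i)) (e i) = μ i := by
        rw [heig, inner_smul_left, real_inner_self_eq_norm_sq, e.orthonormal.1 i]; simp
      rw [← h1, hS, LinearMap.comp_apply, LinearMap.adjoint_inner_left]
      exact real_inner_self_nonneg
    rcases hμi.eq_or_lt with h0 | h0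
    · exact Or.inl h0.symm
    refine Or.inr (csInf_le ⟨0, fun _ h => h.1.le⟩ ⟨h0, ?_⟩)
    refine Module.End.hasEigenvalue_of_hasEigenvector (x := (e i).ofLp)
      ⟨Module.End.mem_eigenspace_iff.2 ?_, ?_⟩
    · have h1 := congrArg WithLp.ofLp (heig i)
      have h2 : S = (A.transpose * A).toEuclideanLin := by
        rw [hS, hT, ← Matrix.toEuclideanLin_conjTranspose_eq_adjoint]
        ext; simp
      rw [h2] at h1
      simpa using h1
    · intro h0'
      have := e.orthonormal.1 i
      have h00 : e i = 0 := by ext j; exact congrFun h0' j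
      rw [h00, norm_zero] at this
      exact zero_ne_one this
  have hcoef : ∀ i, inner ℝ (e i) (S v) = μ i * inner ℝ (e i) v := fun i => by
    rw [← hsym, heig, inner_smul_left]; simp
  have h1 : ‖T v‖ ^ 2 = ∑ i, μ i * (inner ℝ (e i) v) ^ 2 := by
    rw [← real_inner_self_eq_norm_sq, ← LinearMap.adjoint_inner_right,
      show LinearMap.adjoint T (T v) = S v from rfl, ← e.sum_inner_mul_inner]
    refine Finset.sum_congr rfl fun i _ => ?_
    rw [hcoef, real_inner_comm]; ring
  have h2 : ‖S v‖ ^ 2 = ∑ i, (μ i * inner ℝ (e i) v) ^ 2 := by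
    rw [← e.sum_sq_norm_inner_right]
    refine Finset.sum_congr rfl fun i _ => ?_
    rw [hcoef, Real.norm_eq_abs, sq_abs]
  change _ ≤ ‖S v‖ ^ 2
  rw [h1, h2, Finset.mul_sum]
  refine Finset.sum_le_sum fun i _ => ?_
  rcases hσ i with h0 | h0
  · simp [h0]
  · have hσ0 := sigmaMin_nonneg A
    nlinarith [mul_nonneg (mul_nonneg (hσ0.trans h0) (sq_nonneg (inner ℝ (e i) v)))
      (sub_nonneg.2 h0)]

/-! ### Norms and inner products on the product spaces -/

section ProductNorms

variable {n m : ℕ}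

theorem norm_triple_sq (x z : Vec n) (lam : Vec m) :
    ‖triple x z lam‖ ^ 2 = ‖x‖ ^ 2 + ‖z‖ ^ 2 + ‖lam‖ ^ 2 := by
  rw [triple, WithLp.prod_norm_sq_eq_of_L2, WithLp.prod_norm_sq_eq_of_L2, add_assoc]
  rfl

theorem triple_sub (x z x' z' : Vec n) (lam lam' : Vec m) :
    triple x z lam - triple x' z' lam' = triple (x - x') (z - z') (lam - lam') := rfl

theorem norm_le_norm_triple (x z : Vec n) (lam : Vec m) :
    ‖x‖ ≤ ‖triple x z lam‖ ∧ ‖z‖ ≤ ‖triple x z lam‖ ∧ ‖lam‖ ≤ ‖triple x z lam‖ := by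
  have h := norm_triple_sq x z lam
  refine ⟨?_, ?_, ?_⟩ <;>
  · refine le_of_sq_le_sq ?_ (norm_nonneg _)
    nlinarith [sq_nonneg ‖x‖, sq_nonneg ‖z‖, sq_nonneg ‖lam‖]

theorem norm_state_sq (x z : Vec n) (lam : Vec m) (x' z' : Vec n) :
    ‖state x z lam x' z'‖ ^ 2 = ‖x‖ ^ 2 + ‖z‖ ^ 2 + ‖lam‖ ^ 2 + ‖x'‖ ^ 2 + ‖z'‖ ^ 2 := by
  simp only [state, WithLp.prod_norm_sq_eq_of_L2]
  change ‖x‖ ^ 2 + (‖z‖ ^ 2 + (‖lam‖ ^ 2 + (‖x'‖ ^ 2 + ‖z'‖ ^ 2))) = _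
  ring

theorem norm_state_le (x z : Vec n) (lam : Vec m) (x' z' : Vec n) :
    ‖state x z lam x' z'‖ ≤ ‖x‖ + ‖z‖ + ‖lam‖ + ‖x'‖ + ‖z'‖ := by
  refine le_of_sq_le_sq ?_ (by positivity)
  rw [norm_state_sq]
  have h1 := norm_nonneg x
  have h2 := norm_nonneg z
  have h3 := norm_nonneg lam
  have h4 := norm_nonneg x'
  have h5 := norm_nonneg z'
  have : 0 ≤ ‖x‖ * ‖z‖ + ‖x‖ * ‖lam‖ + ‖x‖ * ‖x'‖ + ‖x‖ * ‖z'‖ + ‖z‖ * ‖lam‖ + ‖z‖ * ‖x'‖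
    + ‖z‖ * ‖z'‖ + ‖lam‖ * ‖x'‖ + ‖lam‖ * ‖z'‖ + ‖x'‖ * ‖z'‖ := by positivity
  nlinarith

theorem state_sub (x z x' z' u w u' w' : Vec n) (lam μ : Vec m) :
    state x z lam x' z' - state u w μ u' w'
      = state (x - u) (z - w) (lam - μ) (x' - u') (z' - w') := rfl

theorem inner_state (x z x' z' u w u' w' : Vec n) (lam μ : Vec m) :
    inner ℝ (state x z lam x' z') (state u w μ u' w')
      = inner ℝ x u + inner ℝ z w + inner ℝ lam μ + inner ℝ x' u' + inner ℝ z' w' := by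
  simp only [state, WithLp.prod_inner_apply]
  ring

theorem eq_state (y : State n m) :
    y = state y.fst y.snd.fst y.snd.snd.fst y.snd.snd.snd.fst y.snd.snd.snd.snd := rfl

theorem continuous_triple : Continuous fun q : Vec n × Vec n × Vec m => triple q.1 q.2.1 q.2.2 := by
  unfold triple
  fun_prop

theorem continuous_state :
    Continuous fun q : Vec n × Vec n × Vec m × Vec n × Vec n =>
      state q.1 q.2.1 q.2.2.1 q.2.2.2.1 q.2.2.2.2 := by
  unfold state
  fun_prop

end ProductNorms

/-! ### The Lyapunov function -/

section Lyapunov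

variable {n m : ℕ} (A : Matrix (Fin m) (Fin n) ℝ) (b : Vec m)

/-- Second-order expansion of the penalized constraint, jointly in the primal and the dual
variable. -/
theorem inner_add_penalty_expand (β : ℝ) (x u : Vec n) (lam μ : Vec m) :
    inner ℝ μ (A.toEuclideanLin u - b) + β / 2 * ‖A.toEuclideanLin u - b‖ ^ 2
      = inner ℝ lam (A.toEuclideanLin x - b) + β / 2 * ‖A.toEuclideanLin x - b‖ ^ 2
        + inner ℝ (LinearMap.adjoint A.toEuclideanLin (lam + β • (A.toEuclideanLin x - b))) (u - x)
        + inner ℝ (A.toEuclideanLin x - b) (μ - lam)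
        + inner ℝ (μ - lam) (A.toEuclideanLin (u - x))
        + β / 2 * ‖A.toEuclideanLin (u - x)‖ ^ 2 := by
  set T := A.toEuclideanLin
  rw [LinearMap.adjoint_inner_left, inner_add_left, inner_smul_left,
    show T u - b = (T x - b) + T (u - x) by rw [map_sub]; abel, norm_add_sq_real]
  set r := T x - b
  set e := T (u - x)
  rw [real_inner_comm (μ - lam) r, inner_sub_left μ lam r,
    inner_sub_left μ lam e, inner_add_right]
  simp only [conj_trivial]
  ring

theorem norm_sub_sq_expand {E : Type*} [NormedAddCommGroup E] [InnerProductSpace ℝ E]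
    (x z u w : E) : ‖u - w‖ ^ 2 = ‖x - z‖ ^ 2 + 2 * inner ℝ (x - z) (u - x)
      - 2 * inner ℝ (x - z) (w - z) + ‖(u - x) - (w - z)‖ ^ 2 := by
  rw [show u - w = (x - z) + ((u - x) - (w - z)) by abel, norm_add_sq_real, inner_sub_right]
  ring

/-- The Lyapunov function without the nonsmooth term `g`. -/
noncomputable def smoothLyapunov (h : Vec n → ℝ) (β γ η Lh : ℝ) (y : State n m) : ℝ :=
  h y.fst + (inner ℝ y.snd.snd.fst (A.toEuclideanLin y.fst - b)
    + β / 2 * ‖A.toEuclideanLin y.fst - b‖ ^ 2) + ‖y.fst - y.snd.fst‖ ^ 2 / (2 * γ)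
    + 4 * alpha A β γ η * (‖y.snd.fst - y.snd.snd.snd.snd‖ ^ 2
      + γ ^ 2 * Lh ^ 2 * ‖y.fst - y.snd.snd.snd.fst‖ ^ 2)

variable {A b} {h : Vec n → ℝ} {g : Vec n → EReal} {β γ η Lh ρ : ℝ}

theorem smoothLyapunov_state (x z : Vec n) (lam : Vec m) (x' z' : Vec n) :
    smoothLyapunov A b h β γ η Lh (state x z lam x' z') =
      h x + (inner ℝ lam (A.toEuclideanLin x - b) + β / 2 * ‖A.toEuclideanLin x - b‖ ^ 2)
        + ‖x - z‖ ^ 2 / (2 * γ)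
        + 4 * alpha A β γ η * (‖z - z'‖ ^ 2 + γ ^ 2 * Lh ^ 2 * ‖x - x'‖ ^ 2) := rfl

theorem lyapunov_eq (y : State n m) : lyapunov A b h g β γ η Lh y
    = g y.fst + (smoothLyapunov A b h β γ η Lh y : EReal) := by
  simp only [lyapunov, proxAugLagrangian, augLagrangian, objective, smoothLyapunov]
  rw [add_comm (h y.fst : EReal) (g y.fst)]
  simp only [add_assoc, ← EReal.coe_add]

theorem continuous_smoothLyapunov (hh : Continuous h) :
    Continuous (smoothLyapunov A b h β γ η Lh) := by
  have hT : Continuous A.toEuclideanLin := LinearMap.continuous_of_finiteDimensional _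
  unfold smoothLyapunov
  fun_prop

/-- Adding the gradient of the smooth part to a weak subgradient of `g` gives a weak subgradient of
the Lyapunov function. The only term of indefinite sign in the second-order expansion is the
coupling `⟪δλ, A δx⟫`, which is absorbed by the penalty at the price of `‖δλ‖ ^ 2 / (2 * β)`. -/
theorem isWeakSubgradient_lyapunov (hβ : 0 < β) (hγ : 0 < γ) (hα : 0 ≤ alpha A β γ η)
    (hLh : 0 ≤ Lh) (hρ : 0 ≤ ρ) (hdiff : Differentiable ℝ h)
    (hlip : ∀ u v : Vec n, ‖gradient h u - gradient h v‖ ≤ Lh * ‖u - v‖)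
    {x s : Vec n} (hs : IsWeakSubgradient ρ g x s) (z : Vec n) (lam : Vec m) (x' z' : Vec n) :
    IsWeakSubgradient (ρ + Lh + 1 / β) (lyapunov A b h g β γ η Lh) (state x z lam x' z')
      (state (gradient h x + s
          + LinearMap.adjoint A.toEuclideanLin (lam + β • (A.toEuclideanLin x - b))
          + (1 / γ) • (x - z) + (8 * alpha A β γ η * (γ ^ 2 * Lh ^ 2)) • (x - x'))
        (-(1 / γ) • (x - z) + (8 * alpha A β γ η) • (z - z'))
        (A.toEuclideanLin x - b)
        (-(8 * alpha A β γ η * (γ ^ 2 * Lh ^ 2)) • (x - x'))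
        (-(8 * alpha A β γ η) • (z - z'))) := by
  have hfst : (state x z lam x' z').fst = x := rfl
  refine ⟨?_, fun y => ?_⟩
  · rw [lyapunov_eq, hfst, ← hs.1, ← EReal.coe_add, EReal.toReal_coe]
  rw [lyapunov_eq, lyapunov_eq, hfst, ← hs.1, ← EReal.coe_add, EReal.toReal_coe]
  refine le_trans ?_ (add_le_add_left (hs.2 y.fst) _)
  rw [← EReal.coe_add, EReal.coe_le_coe_iff]
  rw [eq_state y]
  generalize (y.fst : Vec n) = u
  generalize (y.snd.fst : Vec n) = w
  generalize (y.snd.snd.fst : Vec m) = μ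
  generalize (y.snd.snd.snd.fst : Vec n) = u'
  generalize (y.snd.snd.snd.snd : Vec n) = w'
  rw [show (state u w μ u' w').fst = u from rfl, state_sub, inner_state, norm_state_sq,
    smoothLyapunov_state, smoothLyapunov_state, inner_add_penalty_expand A b β x u lam μ,
    norm_sub_sq_expand x z u w, norm_sub_sq_expand z z' w w', norm_sub_sq_expand x x' u u']
  have hh := (abs_le.1 (abs_sub_sub_inner_gradient_le hdiff hlip x u)).1
  have hc : - (1 / (2 * β) * ‖μ - lam‖ ^ 2) ≤ inner ℝ (μ - lam) (A.toEuclideanLin (u - x))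
      + β / 2 * ‖A.toEuclideanLin (u - x)‖ ^ 2 := by
    set e := A.toEuclideanLin (u - x)
    have h1 := neg_le_of_abs_le (abs_real_inner_le_norm (μ - lam) e)
    have h2 : 0 ≤ β / 2 * (‖e‖ - ‖μ - lam‖ / β) ^ 2 := by positivity
    have h3 : β / 2 * (‖e‖ - ‖μ - lam‖ / β) ^ 2 = β / 2 * ‖e‖ ^ 2 - ‖μ - lam‖ * ‖e‖
        + 1 / (2 * β) * ‖μ - lam‖ ^ 2 := by
      field_simp
      ring
    linarith
  simp only [inner_add_left, inner_smul_left, conj_trivial, neg_mul]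
  set α := alpha A β γ η
  have e1 : 0 ≤ ‖(u - x) - (w - z)‖ ^ 2 / (2 * γ) := by positivity
  have e2 : 0 ≤ 4 * α * (‖(w - z) - (w' - z')‖ ^ 2
      + γ ^ 2 * Lh ^ 2 * ‖(u - x) - (u' - x')‖ ^ 2) := by positivity
  have e3 : (‖x - z‖ ^ 2 + 2 * inner ℝ (x - z) (u - x) - 2 * inner ℝ (x - z) (w - z)
      + ‖(u - x) - (w - z)‖ ^ 2) / (2 * γ) = ‖x - z‖ ^ 2 / (2 * γ)
      + 1 / γ * inner ℝ (x - z) (u - x) - 1 / γ * inner ℝ (x - z) (w - z)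
      + ‖(u - x) - (w - z)‖ ^ 2 / (2 * γ) := by
    field_simp
  have e4 : 0 ≤ (ρ + Lh + 1 / β) / 2 * (‖w - z‖ ^ 2 + ‖u' - x'‖ ^ 2 + ‖w' - z'‖ ^ 2) := by
    positivity
  have e5 : 0 ≤ (ρ + Lh) / 2 * ‖μ - lam‖ ^ 2 := by positivity
  have e6 : 0 ≤ 1 / β / 2 * ‖u - x‖ ^ 2 := by positivity
  have e7 : 1 / (2 * β) = 1 / β / 2 := by field_simp
  rw [e7] at hc
  rw [e3]
  linarith

end Lyapunov

/-! ### One iteration of the method -/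

section Iteration

variable {n m : ℕ} {A : Matrix (Fin m) (Fin n) ℝ} {b : Vec m} {h : Vec n → ℝ} {g : Vec n → EReal}
  {β γ η Lh ρ : ℝ}

/-- The objective of the `x`-update without the nonsmooth term `g`. -/
noncomputable def smoothModel (A : Matrix (Fin m) (Fin n) ℝ) (b : Vec m) (h : Vec n → ℝ) (β γ : ℝ)
    (xk z : Vec n) (lam : Vec m) (u : Vec n) : ℝ :=
  h xk + inner ℝ (gradient h xk) (u - xk)
    + (inner ℝ lam (A.toEuclideanLin u - b) + β / 2 * ‖A.toEuclideanLin u - b‖ ^ 2)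
    + ‖u - z‖ ^ 2 / (2 * γ)

theorem prox_objective_eq (xk z : Vec n) (lam : Vec m) (u : Vec n) :
    augLagrangian A b β (linObjective h g xk) u lam + ((‖u - z‖ ^ 2 / (2 * γ) : ℝ) : EReal)
      = g u + (smoothModel A b h β γ xk z lam u : EReal) := by
  simp only [augLagrangian, linObjective, smoothModel]
  rw [add_comm _ (g u)]
  simp only [add_assoc, ← EReal.coe_add]

theorem smoothModel_expand (hγ : 0 < γ) (xk z : Vec n) (lam : Vec m) (p u : Vec n) :
    smoothModel A b h β γ xk z lam u = smoothModel A b h β γ xk z lam p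
      + inner ℝ (gradient h xk
          + LinearMap.adjoint A.toEuclideanLin (lam + β • (A.toEuclideanLin p - b))
          + (1 / γ) • (p - z)) (u - p)
      + (β / 2 * ‖A.toEuclideanLin (u - p)‖ ^ 2 + ‖u - p‖ ^ 2 / (2 * γ)) := by
  unfold smoothModel
  rw [inner_add_penalty_expand A b β p u lam lam, norm_sub_sq_expand p z u z,
    show u - xk = (p - xk) + (u - p) by abel]
  simp only [inner_add_left, inner_add_right, inner_smul_left, conj_trivial, sub_self,
    inner_zero_left, inner_zero_right, sub_zero, mul_zero]
  field_simp
  ring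

/-- The optimality condition of the `x`-update. -/
theorem isWeakSubgradient_of_mem_prox (hγ : 0 < γ) (hproper : Proper g)
    (hweak : WeaklyConvex ρ g) {xk z p : Vec n} {lam : Vec m}
    (hp : p ∈ Prox γ (fun u => augLagrangian A b β (linObjective h g xk) u lam) z) :
    IsWeakSubgradient ρ g p (-(gradient h xk
      + LinearMap.adjoint A.toEuclideanLin (lam + β • (A.toEuclideanLin p - b))
      + (1 / γ) • (p - z))) := by
  have hmin : ∀ u, g p + (smoothModel A b h β γ xk z lam p : EReal)
      ≤ g u + (smoothModel A b h β γ xk z lam u : EReal) := fun u => by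
    rw [← prox_objective_eq, ← prox_objective_eq]
    exact hp u
  have hptop : g p ≠ ⊤ := by
    intro htop
    obtain ⟨u, hu⟩ := hproper.2
    have := hmin u
    rw [htop, EReal.top_add_coe, ← EReal.coe_toReal hu (hproper.1 u), ← EReal.coe_add] at this
    exact absurd this (not_le.2 (EReal.coe_lt_top _))
  refine hweak.isWeakSubgradient_neg hproper.1 hptop hmin fun u =>
    ⟨β / 2 * ‖A.toEuclideanLin (u - p)‖ ^ 2 + ‖u - p‖ ^ 2 / (2 * γ), fun t _ _ => le_of_eq ?_⟩
  rw [smoothModel_expand hγ xk z lam p, add_sub_cancel_left, map_smul, norm_smul, norm_smul,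
    inner_smul_right, mul_pow, mul_pow, Real.norm_eq_abs, sq_abs]
  ring

/-- The Moreau-augmented Lagrangian without the nonsmooth term `g`. -/
noncomputable def smoothProxLagrangian (A : Matrix (Fin m) (Fin n) ℝ) (b : Vec m) (h : Vec n → ℝ)
    (β γ : ℝ) (x z : Vec n) (lam : Vec m) : ℝ :=
  h x + (inner ℝ lam (A.toEuclideanLin x - b) + β / 2 * ‖A.toEuclideanLin x - b‖ ^ 2)
    + ‖x - z‖ ^ 2 / (2 * γ)

theorem smoothProxLagrangian_x_update_le (hβ : 0 < β) (hγ : 0 < γ) (hdiff : Differentiable ℝ h)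
    (hlip : ∀ u v : Vec n, ‖gradient h u - gradient h v‖ ≤ Lh * ‖u - v‖)
    {x z p : Vec n} {lam : Vec m}
    (hs : IsWeakSubgradient ρ g p (-(gradient h x
      + LinearMap.adjoint A.toEuclideanLin (lam + β • (A.toEuclideanLin p - b))
      + (1 / γ) • (p - z)))) (hx : ((g x).toReal : EReal) = g x) :
    (g p).toReal + smoothProxLagrangian A b h β γ p z lam
      ≤ (g x).toReal + smoothProxLagrangian A b h β γ x z lam
        - (1 - γ * (ρ + Lh)) / (2 * γ) * ‖p - x‖ ^ 2 := by
  have h1 := hs.le_toReal hx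
  have h2 := smoothModel_expand (A := A) (b := b) (h := h) (β := β) hγ x z lam p x
  have h3 := (abs_le.1 (abs_sub_sub_inner_gradient_le hdiff hlip x p)).2
  have h4 : 0 ≤ β / 2 * ‖A.toEuclideanLin (x - p)‖ ^ 2 := by positivity
  have h5 : (1 - γ * (ρ + Lh)) / (2 * γ) * ‖p - x‖ ^ 2
      = ‖p - x‖ ^ 2 / (2 * γ) - ρ / 2 * ‖p - x‖ ^ 2 - Lh / 2 * ‖p - x‖ ^ 2 := by
    field_simp
    ring
  rw [norm_sub_rev x p] at h1 h2
  rw [inner_neg_left] at h1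
  simp only [smoothModel, sub_self, inner_zero_right, add_zero] at h2
  rw [h5]
  unfold smoothProxLagrangian
  linarith

theorem norm_sub_sq_z_update (hη : 0 < η) (hγ : 0 < γ) {x z z' : Vec n}
    (hz : z' = z - η • (z - x)) :
    ‖x - z'‖ ^ 2 / (2 * γ)
      = ‖x - z‖ ^ 2 / (2 * γ) - (2 / η - 1) / (2 * γ) * ‖z' - z‖ ^ 2 := by
  have h1 : x - z' = (1 - η) • (x - z) := by rw [hz]; module
  have h2 : z' - z = η • (x - z) := by rw [hz]; module
  rw [h1, h2, norm_smul, norm_smul, mul_pow, mul_pow, Real.norm_eq_abs, Real.norm_eq_abs, sq_abs,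
    sq_abs]
  field_simp
  ring

theorem inner_dual_update {r lam lam' : Vec m} (hl : lam' = lam + β • r) :
    inner ℝ lam' r = inner ℝ lam r + 1 / β * ‖lam' - lam‖ ^ 2 := by
  rw [hl, add_sub_cancel_left, inner_add_left, inner_smul_left, real_inner_self_eq_norm_sq,
    norm_smul, mul_pow, Real.norm_eq_abs, sq_abs, conj_trivial]
  field_simp

/-- The change of the Moreau-augmented Lagrangian in one iteration: the primal updates decrease it,
the dual update increases it. -/
theorem smoothProxLagrangian_step_le (hβ : 0 < β) (hγ : 0 < γ) (hη : 0 < η)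
    (hdiff : Differentiable ℝ h)
    (hlip : ∀ u v : Vec n, ‖gradient h u - gradient h v‖ ≤ Lh * ‖u - v‖)
    {x z x' z' : Vec n} {lam lam' : Vec m}
    (hs : IsWeakSubgradient ρ g x' (-(gradient h x
      + LinearMap.adjoint A.toEuclideanLin lam' + (1 / γ) • (x' - z))))
    (hx : ((g x).toReal : EReal) = g x) (hz : z' = z - η • (z - x'))
    (hl : lam' = lam + β • (A.toEuclideanLin x' - b)) :
    (g x').toReal + smoothProxLagrangian A b h β γ x' z' lam'
      ≤ (g x).toReal + smoothProxLagrangian A b h β γ x z lam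
        - (1 - γ * (ρ + Lh)) / (2 * γ) * ‖x' - x‖ ^ 2
        - (2 / η - 1) / (2 * γ) * ‖z' - z‖ ^ 2 + 1 / β * ‖lam' - lam‖ ^ 2 := by
  have h1 := smoothProxLagrangian_x_update_le (b := b) (lam := lam) hβ hγ hdiff hlip
    (by rw [← hl]; exact hs) hx
  have h2 := norm_sub_sq_z_update hη hγ hz
  have h3 := inner_dual_update hl
  unfold smoothProxLagrangian at h1 ⊢
  rw [h2, h3]
  linarith

/-- The dual step is controlled by the primal steps: it lies in the range of `A`, on which the
adjoint is bounded below, and its image under the adjoint is the difference of two successive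
optimality conditions. -/
theorem norm_sq_dual_step_le (hγ : 0 < γ) {Lg : ℝ}
    (hlip : ∀ u v : Vec n, ‖gradient h u - gradient h v‖ ≤ Lh * ‖u - v‖)
    {x x' x'' z z' w s s' : Vec n} {lam' lam'' : Vec m}
    (hs : s = -(gradient h x + LinearMap.adjoint A.toEuclideanLin lam' + (1 / γ) • (x' - z)))
    (hs' : s' = -(gradient h x' + LinearMap.adjoint A.toEuclideanLin lam''
      + (1 / γ) • (x'' - z')))
    (hss : ‖s' - s‖ ≤ Lg * ‖x'' - x'‖) (hw : lam'' - lam' = A.toEuclideanLin w) :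
    γ ^ 2 * sigmaMin A * ‖lam'' - lam'‖ ^ 2 ≤ 3 * ((1 + γ * Lg) ^ 2 * ‖x'' - x'‖ ^ 2
      + γ ^ 2 * Lh ^ 2 * ‖x' - x‖ ^ 2 + ‖z' - z‖ ^ 2) := by
  set T' := LinearMap.adjoint A.toEuclideanLin
  have h1 : γ • T' (lam'' - lam') = (z' - z) - (x'' - x') - γ • (gradient h x' - gradient h x)
      - γ • (s' - s) := by
    rw [hs, hs', map_sub]
    have e : γ * (1 / γ) = 1 := mul_one_div_cancel hγ.ne'
    simp only [smul_sub, smul_add, smul_neg, smul_smul, e, one_smul]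
    abel
  have h2 : γ * ‖T' (lam'' - lam')‖
      ≤ (1 + γ * Lg) * ‖x'' - x'‖ + γ * Lh * ‖x' - x‖ + ‖z' - z‖ := by
    have e : ‖γ • T' (lam'' - lam')‖ = γ * ‖T' (lam'' - lam')‖ := by
      rw [norm_smul, Real.norm_of_nonneg hγ.le]
    rw [← e, h1]
    refine (norm_sub_le _ _).trans ?_
    have h3 := norm_sub_le ((z' - z) - (x'' - x')) (γ • (gradient h x' - gradient h x))
    have h4 := norm_sub_le (z' - z) (x'' - x')
    rw [norm_smul, Real.norm_of_nonneg hγ.le] at h3 ⊢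
    have h5 := mul_le_mul_of_nonneg_left hss hγ.le
    have h6 := mul_le_mul_of_nonneg_left (hlip x' x) hγ.le
    linarith
  have h3 := sigmaMin_mul_norm_sq_le A w
  rw [← hw] at h3
  set P := (1 + γ * Lg) * ‖x'' - x'‖
  set Q := γ * Lh * ‖x' - x‖
  set R := ‖z' - z‖
  have h4 : (γ * ‖T' (lam'' - lam')‖) ^ 2 ≤ (P + Q + R) ^ 2 := by gcongr
  calc γ ^ 2 * sigmaMin A * ‖lam'' - lam'‖ ^ 2
      ≤ γ ^ 2 * ‖T' (lam'' - lam')‖ ^ 2 := by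
        rw [mul_assoc]; gcongr
    _ = (γ * ‖T' (lam'' - lam')‖) ^ 2 := by ring
    _ ≤ (P + Q + R) ^ 2 := h4
    _ ≤ 3 * (P ^ 2 + Q ^ 2 + R ^ 2) := by
        nlinarith [sq_nonneg (P - Q), sq_nonneg (Q - R), sq_nonneg (P - R)]
    _ = _ := by ring

end Iteration

/-! ### Descent and relative error along the iterates -/

/-- The standing assumptions on the problem, on the parameters and on the iterates. -/
structure Setting {n m : ℕ} (A : Matrix (Fin m) (Fin n) ℝ) (b : Vec m) (h : Vec n → ℝ)
    (g : Vec n → EReal) (Lh ρ : ℝ) (Lg : ℝ → ℝ) (β γ η : ℝ) (x z : ℕ → Vec n)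
    (lam : ℕ → Vec m) : Prop where
  feasible : ∃ u : Vec n, A.toEuclideanLin u = b
  Lh_pos : 0 < Lh
  diff : Differentiable ℝ h
  lip : ∀ u v : Vec n, ‖gradient h u - gradient h v‖ ≤ Lh * ‖u - v‖
  ρ_pos : 0 < ρ
  proper : Proper g
  lsc : LowerSemicontinuous g
  weak : WeaklyConvex ρ g
  implicit : ImplicitLipschitzSubgradient ρ g Lg
  β_pos : 0 < β
  γ_pos : 0 < γ
  γ_lt : γ < 1 / (ρ + Lh)
  η_pos : 0 < η
  η_lt : η < 2
  α_pos : 0 < alpha A β γ η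
  α_lt : alpha A β γ η < min (1 / (8 * γ) * (2 / η - 1))
    ((1 - γ * (ρ + Lh)) / (8 * γ * ((1 + γ * Lg γ) ^ 2 + γ ^ 2 * Lh ^ 2)))
  seq : IsLiMEALSequence A b h g β γ η x z lam

namespace Setting

variable {n m : ℕ} {A : Matrix (Fin m) (Fin n) ℝ} {b : Vec m} {h : Vec n → ℝ} {g : Vec n → EReal}
  {Lh ρ : ℝ} {Lg : ℝ → ℝ} {β γ η : ℝ} {x z : ℕ → Vec n} {lam : ℕ → Vec m}

theorem ρ_lt (S : Setting A b h g Lh ρ Lg β γ η x z lam) : ρ < 1 / γ := by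
  have h1 := S.γ_lt
  rw [lt_div_iff₀ (by linarith [S.ρ_pos, S.Lh_pos])] at h1
  rw [lt_div_iff₀ S.γ_pos]
  nlinarith [mul_pos S.γ_pos S.Lh_pos]

theorem sigmaMin_pos (S : Setting A b h g Lh ρ Lg β γ η x z lam) : 0 < sigmaMin A := by
  refine (sigmaMin_nonneg A).lt_of_ne fun h0 => ?_
  have := S.α_pos
  rw [alpha, ← h0] at this
  simp at this

/-- The subgradient of `g` at `x (k + 1)` provided by the optimality condition of the `x`-update. -/
theorem isWeakSubgradient (S : Setting A b h g Lh ρ Lg β γ η x z lam) (k : ℕ) :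
    IsWeakSubgradient ρ g (x (k + 1)) (-(gradient h (x k)
      + LinearMap.adjoint A.toEuclideanLin (lam (k + 1)) + (1 / γ) • (x (k + 1) - z k))) := by
  have h1 := isWeakSubgradient_of_mem_prox S.γ_pos S.proper S.weak (S.seq k).1
  rwa [← (S.seq k).2.2] at h1

/-- Successive subgradients of `g` are gradients of its Moreau envelope, so the implicit Lipschitz
property applies to them. -/
theorem norm_subgradient_sub_le (S : Setting A b h g Lh ρ Lg β γ η x z lam) {p q s t : Vec n}
    (hs : IsWeakSubgradient ρ g p s) (ht : IsWeakSubgradient ρ g q t) :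
    ‖t - s‖ ≤ Lg γ * ‖q - p‖ := by
  have hγρ : γ < ρ⁻¹ := by
    have := S.ρ_lt
    rw [lt_div_iff₀ S.γ_pos] at this
    rw [← one_div, lt_div_iff₀ S.ρ_pos]
    linarith
  have := (S.implicit γ S.γ_pos hγρ).2 q p _ _ (ht.mem_prox S.γ_pos S.ρ_lt)
    (hs.mem_prox S.γ_pos S.ρ_lt)
  rwa [ht.gradMoreau_eq S.γ_pos S.ρ_lt, hs.gradMoreau_eq S.γ_pos S.ρ_lt] at this

theorem norm_sq_dual_step_le (S : Setting A b h g Lh ρ Lg β γ η x z lam) (k : ℕ) :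
    γ ^ 2 * sigmaMin A * ‖lam (k + 2) - lam (k + 1)‖ ^ 2
      ≤ 3 * ((1 + γ * Lg γ) ^ 2 * ‖x (k + 2) - x (k + 1)‖ ^ 2
        + γ ^ 2 * Lh ^ 2 * ‖x (k + 1) - x k‖ ^ 2 + ‖z (k + 1) - z k‖ ^ 2) := by
  obtain ⟨u, hu⟩ := S.feasible
  refine LiMEAL.norm_sq_dual_step_le (w := β • (x (k + 2) - u)) S.γ_pos S.lip rfl rfl
    (S.norm_subgradient_sub_le (S.isWeakSubgradient k) (S.isWeakSubgradient (k + 1))) ?_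
  rw [(S.seq (k + 1)).2.2, add_sub_cancel_left, map_smul, map_sub, hu]

/-- The value of the Lyapunov function at the `k`-th iterate, paired with the preceding one. It is
meaningful for `k ≥ 1` only: `k - 1` truncates, and `g (x 0)` may be infinite. -/
noncomputable def energy (A : Matrix (Fin m) (Fin n) ℝ) (b : Vec m) (h : Vec n → ℝ)
    (g : Vec n → EReal) (Lh β γ η : ℝ) (x z : ℕ → Vec n) (lam : ℕ → Vec m) (k : ℕ) : ℝ :=
  (g (x k)).toReal
    + smoothLyapunov A b h β γ η Lh (state (x k) (z k) (lam k) (x (k - 1)) (z (k - 1)))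

/-- Sufficient decrease of the Lyapunov function. The increase due to the dual update is paid for by
the primal steps of this and of the previous iteration, with `alpha` chosen such that a fraction of
the dual step is left over. -/
theorem exists_decrease (S : Setting A b h g Lh ρ Lg β γ η x z lam) :
    ∃ a > 0, ∀ k ≥ 1,
      a * ‖triple (x (k + 1)) (z (k + 1)) (lam (k + 1)) - triple (x k) (z k) (lam k)‖ ^ 2
        ≤ energy A b h g Lh β γ η x z lam k - energy A b h g Lh β γ η x z lam (k + 1) := by
  have hβ := S.β_pos
  have hγ := S.γ_pos
  have hη := S.η_pos
  have hη2 := S.η_lt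
  have hσ := S.sigmaMin_pos
  set α := alpha A β γ η with hα
  have hα0 : 0 < α := S.α_pos
  set q := (1 + γ * Lg γ) ^ 2 with hq
  set l := γ ^ 2 * Lh ^ 2 with hl
  have hl0 : 0 < l := by have := S.Lh_pos; positivity
  have hq0 : 0 ≤ q := sq_nonneg _
  set ax := (1 - γ * (ρ + Lh)) / (2 * γ) with hax
  set az := (2 / η - 1) / (2 * γ) with haz
  set κ := γ * η * (1 - η / 2) / (2 * β ^ 2) with hκ
  have hκ0 : 0 < κ := by
    have : 0 < 1 - η / 2 := by linarith
    positivity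
  have hcz : 0 < az - 4 * α := by
    have h1 := lt_of_lt_of_le S.α_lt (min_le_left _ _)
    have h2 : az = 4 * (1 / (8 * γ) * (2 / η - 1)) := by rw [haz]; field_simp; ring
    rw [h2]; linarith
  have hcx : 0 < ax - 4 * α * (l + q) := by
    have h1 := lt_of_lt_of_le S.α_lt (min_le_right _ _)
    rw [lt_div_iff₀ (by positivity)] at h1
    have h2 : ax * (2 * γ) = 1 - γ * (ρ + Lh) := by rw [hax]; field_simp
    have h3 : 0 < (ax - 4 * α * (l + q)) * (2 * γ) := by linarith
    exact pos_of_mul_pos_left h3 (by positivity)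
  -- This identity is the reason for the choice of `alpha`.
  have hακ : α * (γ ^ 2 * sigmaMin A) = 1 / β + κ := by
    rw [hα, alpha, hκ]
    field_simp
  refine ⟨min (ax - 4 * α * (l + q)) (min (az - 4 * α) κ), lt_min hcx (lt_min hcz hκ0),
    fun k hk => ?_⟩
  obtain ⟨j, rfl⟩ : ∃ j, k = j + 1 := ⟨k - 1, by omega⟩
  have h1 := smoothProxLagrangian_step_le (A := A) (b := b) (lam := lam (j + 1)) hβ hγ hη S.diff
    S.lip (S.isWeakSubgradient (j + 1)) (S.isWeakSubgradient j).1 (S.seq (j + 1)).2.1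
    (S.seq (j + 1)).2.2
  have h2 := S.norm_sq_dual_step_le j
  have h3 : 1 / β * ‖lam (j + 2) - lam (j + 1)‖ ^ 2 ≤ α * (3 * (q * ‖x (j + 2) - x (j + 1)‖ ^ 2
      + l * ‖x (j + 1) - x j‖ ^ 2 + ‖z (j + 1) - z j‖ ^ 2))
      - κ * ‖lam (j + 2) - lam (j + 1)‖ ^ 2 := by
    have := mul_le_mul_of_nonneg_left h2 hα0.le
    rw [← mul_assoc, hακ] at this
    linarith
  have e1 : energy A b h g Lh β γ η x z lam (j + 1) = (g (x (j + 1))).toReal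
      + smoothProxLagrangian A b h β γ (x (j + 1)) (z (j + 1)) (lam (j + 1))
      + 4 * α * (‖z (j + 1) - z j‖ ^ 2 + l * ‖x (j + 1) - x j‖ ^ 2) := by
    rw [energy, smoothLyapunov_state, smoothProxLagrangian, Nat.add_sub_cancel]; ring
  have e2 : energy A b h g Lh β γ η x z lam (j + 1 + 1) = (g (x (j + 2))).toReal
      + smoothProxLagrangian A b h β γ (x (j + 2)) (z (j + 2)) (lam (j + 2))
      + 4 * α * (‖z (j + 2) - z (j + 1)‖ ^ 2 + l * ‖x (j + 2) - x (j + 1)‖ ^ 2) := by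
    rw [energy, smoothLyapunov_state, smoothProxLagrangian, Nat.add_sub_cancel]; ring
  rw [e1, e2, triple_sub, norm_triple_sq]
  set X := ‖x (j + 2) - x (j + 1)‖ ^ 2
  set Z := ‖z (j + 2) - z (j + 1)‖ ^ 2
  set Λ := ‖lam (j + 2) - lam (j + 1)‖ ^ 2
  set a := min (ax - 4 * α * (l + q)) (min (az - 4 * α) κ)
  have hX : a * X ≤ (ax - 4 * α * (l + q)) * X :=
    mul_le_mul_of_nonneg_right (min_le_left _ _) (sq_nonneg _)
  have hZ : a * Z ≤ (az - 4 * α) * Z :=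
    mul_le_mul_of_nonneg_right ((min_le_right _ _).trans (min_le_left _ _)) (sq_nonneg _)
  have hΛ : a * Λ ≤ κ * Λ :=
    mul_le_mul_of_nonneg_right ((min_le_right _ _).trans (min_le_right _ _)) (sq_nonneg _)
  have n1 : 0 ≤ α * (q * X) := by positivity
  have n2 : 0 ≤ α * (l * ‖x (j + 1) - x j‖ ^ 2) := by positivity
  have n3 : 0 ≤ α * ‖z (j + 1) - z j‖ ^ 2 := by positivity
  linarith

theorem x_sub_z (S : Setting A b h g Lh ρ Lg β γ η x z lam) (k : ℕ) :
    x (k + 1) - z (k + 1) = (1 / η - 1) • (z (k + 1) - z k) := by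
  have h1 : z (k + 1) - z k = η • (x (k + 1) - z k) := by rw [(S.seq k).2.1]; module
  have h2 : x (k + 1) - z k = (1 / η) • (z (k + 1) - z k) := by
    rw [h1, smul_smul, one_div_mul_cancel S.η_pos.ne', one_smul]
  rw [sub_smul, ← h2]
  module

/-- The Lyapunov function has a subgradient at the `(k + 1)`-st iterate whose norm is at most a
constant times the length of the last step. -/
theorem exists_relative_error (S : Setting A b h g Lh ρ Lg β γ η x z lam) :
    ∃ C > 0, ∀ k, ∃ v ∈ limitingSubdiff (lyapunov A b h g β γ η Lh)
        (state (x (k + 1)) (z (k + 1)) (lam (k + 1)) (x k) (z k)),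
      ‖v‖ ≤ C * ‖triple (x (k + 1)) (z (k + 1)) (lam (k + 1)) - triple (x k) (z k) (lam k)‖ := by
  set α := alpha A β γ η with hα
  have hα0 : 0 < α := S.α_pos
  have hβ := S.β_pos
  have hγ := S.γ_pos
  have hL := S.Lh_pos
  set B := ‖(LinearMap.adjoint A.toEuclideanLin).toContinuousLinearMap‖ with hB
  set M := 8 * α * (γ ^ 2 * Lh ^ 2) with hM
  have hM0 : 0 < M := by positivity
  refine ⟨(Lh + B + 1 / γ + M) + (1 / γ * |1 / η - 1| + 8 * α) + 1 / β + M + 8 * α, by positivity,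
    fun k => ?_⟩
  set d := ‖triple (x (k + 1)) (z (k + 1)) (lam (k + 1)) - triple (x k) (z k) (lam k)‖ with hd
  obtain ⟨dx, dz, dl⟩ : ‖x (k + 1) - x k‖ ≤ d ∧ ‖z (k + 1) - z k‖ ≤ d
      ∧ ‖lam (k + 1) - lam k‖ ≤ d := by
    rw [hd, triple_sub]
    exact norm_le_norm_triple _ _ _
  refine ⟨_, frechetSubdiff_subset_limitingSubdiff _ _ (isWeakSubgradient_lyapunov hβ hγ S.α_pos.le
    hL.le S.ρ_pos.le S.diff S.lip (S.isWeakSubgradient k) (z (k + 1)) (lam (k + 1)) (x k)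
    (z k)).mem_frechetSubdiff, ?_⟩
  refine (norm_state_le _ _ _ _ _).trans ?_
  have hlam : β • (A.toEuclideanLin (x (k + 1)) - b) = lam (k + 1) - lam k := by
    rw [(S.seq k).2.2, add_sub_cancel_left]
  have hr : A.toEuclideanLin (x (k + 1)) - b = (1 / β) • (lam (k + 1) - lam k) := by
    rw [← hlam, smul_smul, one_div_mul_cancel hβ.ne', one_smul]
  have b1 : ‖gradient h (x (k + 1)) + -(gradient h (x k)
        + LinearMap.adjoint A.toEuclideanLin (lam (k + 1)) + (1 / γ) • (x (k + 1) - z k))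
      + LinearMap.adjoint A.toEuclideanLin (lam (k + 1) + β • (A.toEuclideanLin (x (k + 1)) - b))
      + (1 / γ) • (x (k + 1) - z (k + 1)) + M • (x (k + 1) - x k)‖
      ≤ (Lh + B + 1 / γ + M) * d := by
    have e : gradient h (x (k + 1)) + -(gradient h (x k)
        + LinearMap.adjoint A.toEuclideanLin (lam (k + 1)) + (1 / γ) • (x (k + 1) - z k))
      + LinearMap.adjoint A.toEuclideanLin (lam (k + 1) + β • (A.toEuclideanLin (x (k + 1)) - b))
      + (1 / γ) • (x (k + 1) - z (k + 1)) + M • (x (k + 1) - x k)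
      = (gradient h (x (k + 1)) - gradient h (x k))
        + LinearMap.adjoint A.toEuclideanLin (lam (k + 1) - lam k)
        + -((1 / γ) • (z (k + 1) - z k)) + M • (x (k + 1) - x k) := by
      rw [hlam, map_add]
      module
    rw [e]
    refine (norm_add₄_le).trans ?_
    have t1 := (S.lip (x (k + 1)) (x k)).trans (mul_le_mul_of_nonneg_left dx hL.le)
    have t2 : ‖LinearMap.adjoint A.toEuclideanLin (lam (k + 1) - lam k)‖ ≤ B * d :=
      ((LinearMap.adjoint A.toEuclideanLin).toContinuousLinearMap.le_opNorm _).trans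
        (mul_le_mul_of_nonneg_left dl (norm_nonneg _))
    have t3 : ‖-((1 / γ) • (z (k + 1) - z k))‖ ≤ 1 / γ * d := by
      rw [norm_neg, norm_smul, Real.norm_of_nonneg (by positivity)]
      gcongr
    have t4 : ‖M • (x (k + 1) - x k)‖ ≤ M * d := by
      rw [norm_smul, Real.norm_of_nonneg hM0.le]
      gcongr
    linarith
  have b2 : ‖-(1 / γ) • (x (k + 1) - z (k + 1)) + (8 * α) • (z (k + 1) - z k)‖
      ≤ (1 / γ * |1 / η - 1| + 8 * α) * d := by
    refine (norm_add_le _ _).trans ?_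
    rw [S.x_sub_z k, norm_smul, norm_smul, norm_smul, norm_neg, Real.norm_of_nonneg (by positivity),
      Real.norm_eq_abs, Real.norm_of_nonneg (by positivity), ← mul_assoc, ← add_mul]
    gcongr
  have b3 : ‖A.toEuclideanLin (x (k + 1)) - b‖ ≤ 1 / β * d := by
    rw [hr, norm_smul, Real.norm_of_nonneg (by positivity)]
    gcongr
  have b4 : ‖-M • (x (k + 1) - x k)‖ ≤ M * d := by
    rw [norm_smul, norm_neg, Real.norm_of_nonneg hM0.le]
    gcongr
  have b5 : ‖-(8 * α) • (z (k + 1) - z k)‖ ≤ 8 * α * d := by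
    rw [norm_smul, norm_neg, Real.norm_of_nonneg (by positivity)]
    gcongr
  linarith

end Setting

/-! ### Convergence of the values and the Kurdyka–Łojasiewicz inequality along the iterates -/

namespace Setting

variable {n m : ℕ} {A : Matrix (Fin m) (Fin n) ℝ} {b : Vec m} {h : Vec n → ℝ} {g : Vec n → EReal}
  {Lh ρ : ℝ} {Lg : ℝ → ℝ} {β γ η : ℝ} {x z : ℕ → Vec n} {lam : ℕ → Vec m}

theorem coe_energy (S : Setting A b h g Lh ρ Lg β γ η x z lam) (k : ℕ) :
    lyapunov A b h g β γ η Lh (state (x (k + 1)) (z (k + 1)) (lam (k + 1)) (x k) (z k))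
      = (energy A b h g Lh β γ η x z lam (k + 1) : EReal) := by
  rw [lyapunov_eq, energy, EReal.coe_add, (S.isWeakSubgradient k).1, Nat.add_sub_cancel]
  rfl

/-- Along a bounded sequence the energies are bounded below: a weak subgradient at the first iterate
provides a continuous minorant of `g`. -/
theorem exists_energy_lower_bound (S : Setting A b h g Lh ρ Lg β γ η x z lam)
    (hbdd : Bornology.IsBounded (Set.range fun k => (x k, z k, lam k))) :
    ∃ M, ∀ k, M ≤ energy A b h g Lh β γ η x z lam (k + 1) := by
  obtain ⟨R, hR⟩ := hbdd.exists_norm_le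
  have hR' : ∀ k, ‖x k‖ ≤ R ∧ ‖z k‖ ≤ R ∧ ‖lam k‖ ≤ R := fun k => by
    have h1 := hR _ ⟨k, rfl⟩
    exact ⟨(norm_fst_le _).trans h1, (norm_fst_le (x k, z k, lam k).2).trans
      ((norm_snd_le _).trans h1), (norm_snd_le (x k, z k, lam k).2).trans
      ((norm_snd_le _).trans h1)⟩
  set s := -(gradient h (x 0) + LinearMap.adjoint A.toEuclideanLin (lam 1)
    + (1 / γ) • (x 1 - z 0)) with hsdef
  have hs : IsWeakSubgradient ρ g (x 1) s := S.isWeakSubgradient 0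
  set Ψ : State n m → ℝ := fun y => (g (x 1)).toReal + inner ℝ s (y.fst - x 1)
    - ρ / 2 * ‖y.fst - x 1‖ ^ 2 + smoothLyapunov A b h β γ η Lh y with hΨ
  have hcont : Continuous Ψ := by
    have := continuous_smoothLyapunov (A := A) (b := b) (β := β) (γ := γ) (η := η) (Lh := Lh)
      S.diff.continuous
    fun_prop
  have hcpt : IsCompact (Metric.closedBall (0 : State n m) (5 * R)) := isCompact_closedBall _ _
  obtain ⟨M, hM⟩ := (hcpt.image hcont).bddBelow
  refine ⟨M, fun k => ?_⟩
  have hmem : state (x (k + 1)) (z (k + 1)) (lam (k + 1)) (x k) (z k)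
      ∈ Metric.closedBall (0 : State n m) (5 * R) := by
    rw [mem_closedBall_zero_iff]
    refine (norm_state_le _ _ _ _ _).trans ?_
    linarith [(hR' k).1, (hR' k).2.1, (hR' (k + 1)).1, (hR' (k + 1)).2.1, (hR' (k + 1)).2.2]
  refine (hM ⟨_, hmem, rfl⟩).trans ?_
  have h1 := hs.le_toReal (S.isWeakSubgradient k).1
  exact add_le_add_left h1 _

/-- The energies converge. -/
theorem exists_tendsto_energy (S : Setting A b h g Lh ρ Lg β γ η x z lam)
    (hbdd : Bornology.IsBounded (Set.range fun k => (x k, z k, lam k))) :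
    ∃ ℓ, Tendsto (energy A b h g Lh β γ η x z lam) atTop (𝓝 ℓ) := by
  obtain ⟨a, ha, hdec⟩ := S.exists_decrease
  obtain ⟨M, hM⟩ := S.exists_energy_lower_bound hbdd
  have hanti : Antitone fun k => energy A b h g Lh β γ η x z lam (k + 1) :=
    antitone_nat_of_succ_le fun k => by
      have h1 := hdec (k + 1) (by omega)
      have h2 : 0 ≤ a * ‖triple (x (k + 1 + 1)) (z (k + 1 + 1)) (lam (k + 1 + 1))
        - triple (x (k + 1)) (z (k + 1)) (lam (k + 1))‖ ^ 2 := by positivity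
      linarith
  have := tendsto_atTop_ciInf hanti ⟨M, by rintro _ ⟨k, rfl⟩; exact hM k⟩
  exact ⟨_, (tendsto_add_atTop_iff_nat 1).1 this⟩

/-- The steps tend to zero. -/
theorem tendsto_step (S : Setting A b h g Lh ρ Lg β γ η x z lam)
    (hbdd : Bornology.IsBounded (Set.range fun k => (x k, z k, lam k))) :
    Tendsto (fun k => ‖triple (x (k + 1)) (z (k + 1)) (lam (k + 1))
      - triple (x k) (z k) (lam k)‖) atTop (𝓝 0) := by
  obtain ⟨a, ha, hdec⟩ := S.exists_decrease
  obtain ⟨ℓ, hℓ⟩ := S.exists_tendsto_energy hbdd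
  have h1 : Tendsto (fun k => (energy A b h g Lh β γ η x z lam k
      - energy A b h g Lh β γ η x z lam (k + 1)) / a) atTop (𝓝 0) := by
    simpa using (hℓ.sub ((tendsto_add_atTop_iff_nat 1).2 hℓ)).div_const a
  have h2 := h1.sqrt
  rw [Real.sqrt_zero] at h2
  refine squeeze_zero' (Eventually.of_forall fun _ => norm_nonneg _) ?_ h2
  filter_upwards [eventually_ge_atTop 1] with k hk
  apply Real.le_sqrt_of_sq_le
  rw [le_div_iff₀ ha]
  linarith [hdec k hk]

/-- A limit point of the pairs `(x, lam)` is the limit of a subsequence of all the blocks, with the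
preceding iterates included: the steps tend to zero and `x - z` is proportional to a step. -/
theorem exists_subseq_tendsto (S : Setting A b h g Lh ρ Lg β γ η x z lam)
    (hbdd : Bornology.IsBounded (Set.range fun k => (x k, z k, lam k)))
    {xs : Vec n} {lams : Vec m} (hlim : MapClusterPt (xs, lams) atTop fun k => (x k, lam k)) :
    ∃ φ : ℕ → ℕ, Tendsto φ atTop atTop ∧
      Tendsto (fun j => x (φ j + 1)) atTop (𝓝 xs) ∧ Tendsto (fun j => z (φ j + 1)) atTop (𝓝 xs) ∧
      Tendsto (fun j => lam (φ j + 1)) atTop (𝓝 lams) ∧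
      Tendsto (fun j => x (φ j)) atTop (𝓝 xs) ∧ Tendsto (fun j => z (φ j)) atTop (𝓝 xs) := by
  have hstep := S.tendsto_step hbdd
  have hblock : ∀ k, ‖x (k + 1) - x k‖ ≤ ‖triple (x (k + 1)) (z (k + 1)) (lam (k + 1))
        - triple (x k) (z k) (lam k)‖ ∧
      ‖z (k + 1) - z k‖ ≤ ‖triple (x (k + 1)) (z (k + 1)) (lam (k + 1))
        - triple (x k) (z k) (lam k)‖ := fun k => by
    rw [triple_sub]
    exact ⟨(norm_le_norm_triple _ _ _).1, (norm_le_norm_triple _ _ _).2.1⟩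
  have hdx : Tendsto (fun k => x (k + 1) - x k) atTop (𝓝 0) :=
    squeeze_zero_norm (fun k => (hblock k).1) hstep
  have hdz : Tendsto (fun k => z (k + 1) - z k) atTop (𝓝 0) :=
    squeeze_zero_norm (fun k => (hblock k).2) hstep
  obtain ⟨ψ, hψ, hψlim⟩ := hlim.tendsto_subseq
  have hshift : Tendsto (fun j => (x (ψ (j + 1)), lam (ψ (j + 1)))) atTop (𝓝 (xs, lams)) :=
    hψlim.comp (tendsto_add_atTop_nat 1)
  set φ : ℕ → ℕ := fun j => ψ (j + 1) - 1 with hφ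
  have hφ1 : ∀ j, φ j + 1 = ψ (j + 1) := fun j => by
    have := hψ.id_le (j + 1)
    simp only [hφ]
    simp only [id] at this
    omega
  have hφt : Tendsto φ atTop atTop := tendsto_atTop_mono (fun j => by
    have := hψ.id_le (j + 1)
    change j ≤ ψ (j + 1) - 1
    simp only [id] at this
    omega) tendsto_id
  have hx : Tendsto (fun j => x (φ j + 1)) atTop (𝓝 xs) := by
    simp only [hφ1]; exact hshift.fst_nhds
  have hl : Tendsto (fun j => lam (φ j + 1)) atTop (𝓝 lams) := by
    simp only [hφ1]; exact hshift.snd_nhds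
  have hz : Tendsto (fun j => z (φ j + 1)) atTop (𝓝 xs) := by
    have h1 := hx.sub ((hdz.comp hφt).const_smul (1 / η - 1))
    simp only [smul_zero, sub_zero] at h1
    refine h1.congr fun j => ?_
    rw [Function.comp_apply, ← S.x_sub_z, sub_sub_cancel]
  refine ⟨φ, hφt, hx, hz, hl, ?_, ?_⟩
  · have h1 := hx.sub (hdx.comp hφt)
    rw [sub_zero] at h1
    exact h1.congr fun j => by rw [Function.comp_apply, sub_sub_cancel]
  · have h1 := hz.sub (hdz.comp hφt)
    rw [sub_zero] at h1
    exact h1.congr fun j => by rw [Function.comp_apply, sub_sub_cancel]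

/-- The energies converge to the value of the Lyapunov function at the limit point. Lower
semicontinuity of `g` gives one inequality; the other one holds because the subgradients of `g` at
the iterates converge along the subsequence. -/
theorem tendsto_energy (S : Setting A b h g Lh ρ Lg β γ η x z lam)
    (hbdd : Bornology.IsBounded (Set.range fun k => (x k, z k, lam k)))
    {xs : Vec n} {lams : Vec m} (hlim : MapClusterPt (xs, lams) atTop fun k => (x k, lam k)) :
    ∃ P : ℝ, lyapunov A b h g β γ η Lh (state xs xs lams xs xs) = P ∧
      Tendsto (energy A b h g Lh β γ η x z lam) atTop (𝓝 P) := by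
  obtain ⟨ℓ, hℓ⟩ := S.exists_tendsto_energy hbdd
  obtain ⟨φ, hφ, hx, hz, hl, hx', hz'⟩ := S.exists_subseq_tendsto hbdd hlim
  set Q := smoothLyapunov A b h β γ η Lh (state xs xs lams xs xs) with hQ
  have hstate : Tendsto (fun j => state (x (φ j + 1)) (z (φ j + 1)) (lam (φ j + 1)) (x (φ j))
      (z (φ j))) atTop (𝓝 (state xs xs lams xs xs)) :=
    (continuous_state.tendsto (xs, xs, lams, xs, xs)).comp
      (hx.prodMk_nhds (hz.prodMk_nhds (hl.prodMk_nhds (hx'.prodMk_nhds hz'))))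
  have hsm := ((continuous_smoothLyapunov (A := A) (b := b) (β := β) (γ := γ) (η := η) (Lh := Lh)
    S.diff.continuous).tendsto _).comp hstate
  have hc : Tendsto (fun j => (g (x (φ j + 1))).toReal) atTop (𝓝 (ℓ - Q)) := by
    have h1 := (hℓ.comp ((tendsto_add_atTop_nat 1).comp hφ)).sub hsm
    refine h1.congr fun j => ?_
    simp only [Function.comp_apply, energy, Nat.add_sub_cancel]
    ring
  have hle : g xs ≤ ((ℓ - Q : ℝ) : EReal) := by
    refine le_of_forall_lt fun c hcx => ?_
    obtain ⟨c', hcc', hc'⟩ := exists_between hcx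
    have h1 := hx.eventually (S.lsc xs c' hc')
    have h2 : Tendsto (fun j => g (x (φ j + 1))) atTop (𝓝 ((ℓ - Q : ℝ) : EReal)) :=
      ((continuous_coe_real_ereal.tendsto _).comp hc).congr fun j => (S.isWeakSubgradient (φ j)).1
    exact hcc'.trans_le (ge_of_tendsto h2 (h1.mono fun j hj => hj.le))
  have hfin : ((g xs).toReal : EReal) = g xs :=
    EReal.coe_toReal (ne_top_of_le_ne_top (EReal.coe_ne_top _) hle) (S.proper.1 xs)
  have hgrad : Continuous (gradient h) :=
    (LipschitzWith.of_dist_le_mul (K := ⟨Lh, S.Lh_pos.le⟩) fun u v => by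
      rw [dist_eq_norm, dist_eq_norm]; exact S.lip u v).continuous
  have hadj : Continuous (LinearMap.adjoint A.toEuclideanLin) :=
    LinearMap.continuous_of_finiteDimensional _
  have hge : ℓ - Q ≤ (g xs).toReal := by
    have hs := (((hgrad.tendsto xs).comp hx').add ((hadj.tendsto lams).comp hl)).add
      ((hx.sub hz').const_smul (1 / γ))
    have hd : Tendsto (fun j => xs - x (φ j + 1)) atTop (𝓝 (xs - xs)) := tendsto_const_nhds.sub hx
    have h1 := (hc.add (hs.neg.inner hd)).sub ((hd.norm.pow 2).const_mul (ρ / 2))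
    simp only [sub_self, inner_zero_right, add_zero, norm_zero, ne_eq, OfNat.ofNat_ne_zero,
      not_false_eq_true, zero_pow, mul_zero, sub_zero] at h1
    exact le_of_tendsto h1 (Eventually.of_forall fun j =>
      (S.isWeakSubgradient (φ j)).le_toReal hfin)
  have heq : (g xs).toReal = ℓ - Q :=
    le_antisymm (by rw [← hfin] at hle; exact_mod_cast hle) hge
  refine ⟨ℓ, ?_, hℓ⟩
  rw [lyapunov_eq, show (state xs xs lams xs xs).fst = xs from rfl, ← hfin, heq, ← EReal.coe_add,
    ← hQ, sub_add_cancel]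

theorem mapClusterPt_triple (S : Setting A b h g Lh ρ Lg β γ η x z lam)
    (hbdd : Bornology.IsBounded (Set.range fun k => (x k, z k, lam k)))
    {xs : Vec n} {lams : Vec m} (hlim : MapClusterPt (xs, lams) atTop fun k => (x k, lam k)) :
    MapClusterPt (triple xs xs lams) atTop fun k => triple (x k) (z k) (lam k) := by
  obtain ⟨φ, hφ, hx, hz, hl, -, -⟩ := S.exists_subseq_tendsto hbdd hlim
  have h1 : Tendsto (fun j => triple (x (φ j + 1)) (z (φ j + 1)) (lam (φ j + 1))) atTop
      (𝓝 (triple xs xs lams)) :=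
    (continuous_triple.tendsto (xs, xs, lams)).comp (hx.prodMk_nhds (hz.prodMk_nhds hl))
  exact MapClusterPt.of_comp ((tendsto_add_atTop_nat 1).comp hφ) h1.mapClusterPt

/-- The Kurdyka–Łojasiewicz inequality combined with the relative error estimate. -/
theorem exists_kl_along_iterates (S : Setting A b h g Lh ρ Lg β γ η x z lam)
    (hbdd : Bornology.IsBounded (Set.range fun k => (x k, z k, lam k)))
    {xs : Vec n} {lams : Vec m} {θ P : ℝ} (hθ : θ < 1)
    (hKL : HasKLProperty (lyapunov A b h g β γ η Lh) (state xs xs lams xs xs) θ)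
    (hP : lyapunov A b h g β γ η Lh (state xs xs lams xs xs) = P)
    (hE : Tendsto (energy A b h g Lh β γ η x z lam) atTop (𝓝 P)) :
    ∃ C > 0, ∃ ε > 0, ∀ᶠ k in atTop,
      ‖triple (x (k + 1)) (z (k + 1)) (lam (k + 1)) - triple xs xs lams‖ < ε →
      0 < energy A b h g Lh β γ η x z lam (k + 1) - P →
      1 ≤ C * (energy A b h g Lh β γ η x z lam (k + 1) - P) ^ (-θ)
        * ‖triple (x (k + 1)) (z (k + 1)) (lam (k + 1)) - triple (x k) (z k) (lam k)‖ := by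
  obtain ⟨-, U, hU, ν, hν, c, hc, hineq⟩ := hKL
  obtain ⟨δ, hδ, hball⟩ := Metric.mem_nhds_iff.1 hU
  obtain ⟨C, hC, herr⟩ := S.exists_relative_error
  have hstep := (S.tendsto_step hbdd).eventually (gt_mem_nhds (show 0 < δ / 4 by linarith))
  have hval := ((tendsto_add_atTop_iff_nat 1).2 hE).eventually
    (gt_mem_nhds (show P < P + ν by linarith))
  have h1θ : 0 < 1 - θ := by linarith
  refine ⟨c * (1 - θ) * C, by positivity, δ / 10, by positivity, ?_⟩
  filter_upwards [hstep, hval] with k hk hkν hnear hpos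
  set r := energy A b h g Lh β γ η x z lam (k + 1) - P with hr
  obtain ⟨v, hv, hvle⟩ := herr k
  set d := ‖triple (x (k + 1)) (z (k + 1)) (lam (k + 1)) - triple (x k) (z k) (lam k)‖ with hd
  set y := state (x (k + 1)) (z (k + 1)) (lam (k + 1)) (x k) (z k) with hy
  have hyU : y ∈ U := by
    refine hball ?_
    rw [Metric.mem_ball, dist_eq_norm, hy, state_sub]
    refine (norm_state_le _ _ _ _ _).trans_lt ?_
    rw [triple_sub] at hnear
    obtain ⟨n1, n2, n3⟩ := norm_le_norm_triple (x (k + 1) - xs) (z (k + 1) - xs)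
      (lam (k + 1) - lams)
    rw [hd, triple_sub] at hk
    obtain ⟨d1, d2, -⟩ := norm_le_norm_triple (x (k + 1) - x k) (z (k + 1) - z k)
      (lam (k + 1) - lam k)
    have e1 := norm_sub_le_norm_sub_add_norm_sub (x k) (x (k + 1)) xs
    have e2 := norm_sub_le_norm_sub_add_norm_sub (z k) (z (k + 1)) xs
    rw [norm_sub_rev (x k) (x (k + 1))] at e1
    rw [norm_sub_rev (z k) (z (k + 1))] at e2
    linarith
  have hkl := hineq y ⟨hyU, ⟨v, hv⟩⟩
    (by rw [hP, S.coe_energy, EReal.coe_lt_coe_iff]; linarith)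
    (by rw [hP, S.coe_energy, ← EReal.coe_add, EReal.coe_lt_coe_iff]; exact hkν)
  rw [hP, S.coe_energy, EReal.toReal_coe, EReal.toReal_coe, ← hr] at hkl
  have hderiv : deriv (fun s : ℝ => c * s ^ (1 - θ)) r = c * (1 - θ) * r ^ (-θ) := by
    have := (Real.hasDerivAt_rpow_const (x := r) (p := 1 - θ) (Or.inl hpos.ne')).const_mul c
    rw [this.deriv, show 1 - θ - 1 = -θ by ring]
    ring
  rw [hderiv] at hkl
  have hdist : Metric.infDist 0 (limitingSubdiff (lyapunov A b h g β γ η Lh) y) ≤ C * d := by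
    refine (Metric.infDist_le_dist_of_mem hv).trans ?_
    rw [dist_zero_left]
    exact hvle
  have hrθ : 0 < r ^ (-θ) := Real.rpow_pos_of_pos hpos _
  calc 1 ≤ c * (1 - θ) * r ^ (-θ) * Metric.infDist 0
        (limitingSubdiff (lyapunov A b h g β γ η Lh) y) := hkl
    _ ≤ c * (1 - θ) * r ^ (-θ) * (C * d) := by gcongr
    _ = _ := by ring

end Setting

end LiMEAL

theorem proposition3 {n m : ℕ} (A : Matrix (Fin m) (Fin n) ℝ) (b : LiMEAL.Vec m)
    (h : LiMEAL.Vec n → ℝ) (g : LiMEAL.Vec n → EReal)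
    (Lh ρg : ℝ) (Lg : ℝ → ℝ) (β γ η θ : ℝ)
    (x z : ℕ → LiMEAL.Vec n) (lam : ℕ → LiMEAL.Vec m)
    (xs : LiMEAL.Vec n) (lams : LiMEAL.Vec m)
    -- the constraint `A x = b` is feasible
    (hfeas : ∃ u : LiMEAL.Vec n, A.toEuclideanLin u = b)
    -- `h` is differentiable with an `Lh`-Lipschitz gradient
    (hLh : 0 < Lh) (hdiff : Differentiable ℝ h)
    (hlip : ∀ u v : LiMEAL.Vec n, ‖gradient h u - gradient h v‖ ≤ Lh * ‖u - v‖)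
    -- `g` is proper, lower semicontinuous and `ρg`-weakly convex
    (hρg : 0 < ρg) (hproper : LiMEAL.Proper g) (hlsc : LowerSemicontinuous g)
    (hweak : LiMEAL.WeaklyConvex ρg g)
    -- `g` has the implicit Lipschitz subgradient property
    (himp : LiMEAL.ImplicitLipschitzSubgradient ρg g Lg)
    -- the parameters
    (hβ : 0 < β) (hγ : 0 < γ) (hγ' : γ < 1 / (ρg + Lh)) (hη : 0 < η) (hη' : η < 2)
    (hα : 0 < LiMEAL.alpha A β γ η)
    (hα' : LiMEAL.alpha A β γ η <
      min (1 / (8 * γ) * (2 / η - 1))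
        ((1 - γ * (ρg + Lh)) / (8 * γ * ((1 + γ * Lg γ) ^ 2 + γ ^ 2 * Lh ^ 2))))
    -- a bounded sequence generated by LiMEAL
    (hseq : LiMEAL.IsLiMEALSequence A b h g β γ η x z lam)
    (hbdd : Bornology.IsBounded (Set.range fun k => (x k, z k, lam k)))
    -- a limit point, at which the Lyapunov function has the Kurdyka–Łojasiewicz property
    (hlim : MapClusterPt (xs, lams) atTop fun k => (x k, lam k))
    (hθ : 0 ≤ θ) (hθ' : θ < 1)
    (hKL : LiMEAL.HasKLProperty (LiMEAL.lyapunov A b h g β γ η Lh)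
      (LiMEAL.state xs xs lams xs xs) θ) :
    Tendsto (fun k => LiMEAL.triple (x k) (z k) (lam k)) atTop (𝓝 (LiMEAL.triple xs xs lams)) ∧
    (θ = 0 → ∃ k₀ : ℕ, ∀ k ≥ k₀,
      LiMEAL.triple (x k) (z k) (lam k) = LiMEAL.triple xs xs lams) ∧
    (0 < θ → θ ≤ 1 / 2 → ∃ k₀ : ℕ, 0 < k₀ ∧ ∃ c : ℝ, 0 < c ∧ ∃ τ : ℝ, 0 < τ ∧ τ < 1 ∧
      ∀ k ≥ k₀,
        ‖LiMEAL.triple (x k) (z k) (lam k) - LiMEAL.triple xs xs lams‖ ≤ c * τ ^ k) ∧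
    (1 / 2 < θ → ∃ k₀ : ℕ, 0 < k₀ ∧ ∃ c : ℝ, 0 < c ∧
      ∀ k ≥ k₀,
        ‖LiMEAL.triple (x k) (z k) (lam k) - LiMEAL.triple xs xs lams‖
          ≤ c * (k : ℝ) ^ (-((1 - θ) / (2 * θ - 1)))) := by
  have S : LiMEAL.Setting A b h g Lh ρg Lg β γ η x z lam :=
    ⟨hfeas, hLh, hdiff, hlip, hρg, hproper, hlsc, hweak, himp, hβ, hγ, hγ', hη, hη', hα, hα', hseq⟩
  obtain ⟨P, hP, hE⟩ := S.tendsto_energy hbdd hlim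
  obtain ⟨a, ha, hdec⟩ := S.exists_decrease
  obtain ⟨C, hC, ε, hε, hkl⟩ := S.exists_kl_along_iterates hbdd hθ' hKL hP hE
  refine LiMEAL.tendsto_and_rates_of_kl ha hC hθ hθ' hε (fun k hk => ?_)
    (by simpa using hE.sub_const P) hkl (S.mapClusterPt_triple hbdd hlim)
  rw [sub_sub_sub_cancel_right]
  exact hdec k hk
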